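/- \textbf{The model.} Let $a_0,a_2,b_0,b_2>0$ with $a_2b_0-a_0b_2\neq0$, put $\beta_0=\frac{a_0+b_0}{2a_0}$, $\beta_2=\frac{a_2+b_2}{2b_2}$, and assume $\beta_2>2$ and $\beta:=\beta_0/\beta_2<1$. Consider the neutral saddle $$\dot x=x(a_0x^2+a_2z^2),\qquad \dot z=-z(b_0x^2+b_2z^2).$$ For $0<x\le1$ let $T(x)\ge0$ be the time (Dulac time) at which the orbit starting at $(x,1)$ reaches the line $\{x=1\}$, and let $(1,D(x))$ be the point where it does so (Dulac map). Let $1<a\le2$ and let $\theta_\pm:[0,1]\to(0,\infty)$ be of class $C^1$ (the flight times of the flow from the exit sections $\{x=\pm1\}$ back to the cross-section $\{z=1\}$, as functions of the exit height). With $I=[-1,1]$ define on $I\setminus\{0\}$ $$f_{\mathrm{Neu}}(x)=\begin{cases}aD(x)-1,&x>0,\\ 1-aD(|x|),&x<0,\end{cases}\qquad \tau_2(x)=\begin{cases}\theta_+(D(x)),&x>0,\\ \theta_-(D(|x|)),&x<0,\end{cases}\qquad r_{\mathrm{Neu}}(x)=T(|x|)+\tau_2(x).$$ \textbf{Hyperbolic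 times.} Let $\sigma\in(0,1)$, $\delta>0$, $c\in(0,\frac12]$, and let $\mathrm{dist}_\delta(x)=|x|$ if $|x|<\delta$ and $=1$ otherwise. An integer $n\ge1$ is a $(\sigma,\delta)$-hyperbolic time (with exponent $c$) for $x$ if for all $1\le k\le n$ $$\prod_{j=n-k}^{n-1}|f_{\mathrm{Neu}}'(f_{\mathrm{Neu}}^j(x))|^{-1}\le\sigma^k\quad\text{and}\quad \mathrm{dist}_\delta(f_{\mathrm{Neu}}^{n-k}(x))\ge\sigma^{ck}.$$ \textbf{The induced map.} Let $\tilde X\subset I$ be an open interval containing $0$, $\tilde{\mathcal Q}$ a countable family of pairwise disjoint non-empty open subintervals covering $\tilde X$ up to a Lebesgue null set, and $\tau:\bigcup\tilde{\mathcal Q}\to\mathbb{Z}^+$ a function that is constant on each $\tilde Q\in\tilde{\mathcal Q}$, such that for every $\tilde Q$ the orbits of points of $\tilde Q$ do not meet $0$ before time $\tau$ and $\tilde F=f_{\mathrm{Neu}}^{\tau}$ maps $\tilde Q$ onto $\tilde X$ as a $C^2$ diffeomorphism. Assume that $\tilde F$ is uniformly expanding ($|\tilde F'|\ge\rho$ for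 some $\rho>1$) and has bounded distortion (there are $K$ and $\alpha>0$ with $\left|\log\frac{|\tilde F'(x)|}{|\tilde F'(y)|}\right|\le K|\tilde F(x)-\tilde F(y)|^\alpha$ for all $x,y$ in the same $\tilde Q$). Assume finally that $\tilde F$ is obtained from hyperbolic times: there are $\sigma\in(0,1)$, $\delta>0$, $c\in(0,\frac12]$ and $N\in\mathbb{N}$ such that for all $\tilde Q\in\tilde{\mathcal Q}$ and $x\in\tilde Q$ the time $\tau(x)$ is the sum of a $(\sigma,\delta)$-hyperbolic time with exponent $c$ for $x$ and an integer in $\{0,\dots,N\}$. Let $R(x)=\sum_{k=0}^{\tau(x)-1}r_{\mathrm{Neu}}(f_{\mathrm{Neu}}^k(x))$ be the induced roof function, and let $\mathcal H$ be the set of all inverse branches $h:\tilde X\to\tilde Q$, $\tilde Q\in\tilde{\mathcal Q}$, of $\tilde F$. \textbf{Proposition.} For every $h\in\mathcal H$ the function $R\circ h$ is differentiable on $\tilde X$, and $$\sup_{h\in\mathcal H}\ \sup_{x\in\tilde X}|D(R\circ h)(x)|<\infty.$$ -/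

import Mathlib

open Set Filter Topology MeasureTheory

noncomputable section

/-- The horizontal cubic vector field of the neutral saddle,
`x' = x (a₀ x² + a₂ z²)`, `z' = - z (b₀ x² + b₂ z²)`, at the point `p = (x, z)`. -/
def neutralField (a₀ a₂ b₀ b₂ : ℝ) (p : ℝ × ℝ) : ℝ × ℝ :=
  (p.1 * (a₀ * p.1 ^ 2 + a₂ * p.2 ^ 2), -(p.2 * (b₀ * p.1 ^ 2 + b₂ * p.2 ^ 2)))

/-- `γ` restricted to `[0, T]` is the orbit segment of the neutral saddle which starts at the
point `(x, 1)` of the entry section `z = 1` and ends at the point `(1, w)` of the exit section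
`x = 1`. -/
structure IsDulacOrbit (a₀ a₂ b₀ b₂ x T w : ℝ) (γ : ℝ → ℝ × ℝ) : Prop where
  time_nonneg : 0 ≤ T
  start : γ 0 = (x, 1)
  solves : ∀ t ∈ Icc 0 T,
    HasDerivWithinAt γ (neutralField a₀ a₂ b₀ b₂ (γ t)) (Icc 0 T) t
  exit : γ T = (1, w)

/-- The Dulac time: the time the orbit of `(x, 1)`, `0 < x ≤ 1`, needs to reach the exit section.
(The first coordinate increases along orbits, so there is exactly one such time.) -/
def dulacTime (a₀ a₂ b₀ b₂ x : ℝ) : ℝ :=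
  sInf {T | ∃ w γ, IsDulacOrbit a₀ a₂ b₀ b₂ x T w γ}

/-- The Dulac map: the height at which the orbit of `(x, 1)`, `0 < x ≤ 1`, crosses the exit
section. (There is exactly one such height.) -/
def dulacMap (a₀ a₂ b₀ b₂ x : ℝ) : ℝ :=
  sInf {w | ∃ T γ, IsDulacOrbit a₀ a₂ b₀ b₂ x T w γ}

/-- The parameters of a neutral geometrical Lorenz model, reduced to the leaf space of its
stable foliation. The coefficients `a₀, a₂, b₀, b₂` belong to the neutral saddle; the flow from
the exit sections `x = ± 1` back to the cross-section `z = 1` expands by the factor `a`, and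
`θpos`, `θneg` are its flight times as functions of the height `w ∈ [0, 1]` at which the orbit
leaves the exit section `x = 1`, respectively `x = -1`. -/
structure NeutralModel where
  (a₀ a₂ b₀ b₂ a : ℝ)
  (θpos θneg : ℝ → ℝ)
  a₀_pos : 0 < a₀
  a₂_pos : 0 < a₂
  b₀_pos : 0 < b₀
  b₂_pos : 0 < b₂
  discr_ne : a₂ * b₀ - a₀ * b₂ ≠ 0
  /-- `β₂ > 2`. -/
  two_lt_beta₂ : 2 < (a₂ + b₂) / (2 * b₂)
  /-- `β = β₀ / β₂ < 1`. -/
  beta₀_lt_beta₂ : (a₀ + b₀) / (2 * a₀) < (a₂ + b₂) / (2 * b₂)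
  one_lt_a : 1 < a
  /-- The one-dimensional map sends `[-1, 1] \ {0}` into `[-1, 1]`. -/
  a_le_two : a ≤ 2
  θpos_pos : ∀ w ∈ Icc (0 : ℝ) 1, 0 < θpos w
  θneg_pos : ∀ w ∈ Icc (0 : ℝ) 1, 0 < θneg w
  θpos_smooth : ContDiffOn ℝ 1 θpos (Icc 0 1)
  θneg_smooth : ContDiffOn ℝ 1 θneg (Icc 0 1)

namespace NeutralModel

/-- The Dulac map of the model at distance `x` from the stable manifold of the saddle. -/
def dulac (M : NeutralModel) (x : ℝ) : ℝ := dulacMap M.a₀ M.a₂ M.b₀ M.b₂ x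

/-- The one-dimensional Lorenz-like map on `[-1, 1] \ {0}` (the value at `0` is irrelevant). -/
def f (M : NeutralModel) (x : ℝ) : ℝ :=
  if 0 < x then M.a * M.dulac x - 1
  else if x < 0 then 1 - M.a * M.dulac (-x)
  else 0

/-- The flight time from the exit sections back to the cross-section, as a function of the
starting point in the cross-section. -/
def τ₂ (M : NeutralModel) (x : ℝ) : ℝ :=
  if 0 < x then M.θpos (M.dulac x) else M.θneg (M.dulac (-x))

/-- The return time (roof function) `r` on `[-1, 1] \ {0}`: Dulac time plus flight time. -/
def r (M : NeutralModel) (x : ℝ) : ℝ :=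
  dulacTime M.a₀ M.a₂ M.b₀ M.b₂ |x| + M.τ₂ x

end NeutralModel

/-- The distance to the singularity `0`, truncated at scale `δ`. -/
def truncDist (δ x : ℝ) : ℝ := if |x| < δ then |x| else 1

/-- `n` is a `(σ, δ)`-hyperbolic time (with recurrence exponent `c`) of `f` for the point `x`;
the singular set is `{0}`. -/
def IsHyperbolicTime (f : ℝ → ℝ) (σ δ c : ℝ) (n : ℕ) (x : ℝ) : Prop :=
  ∀ k, 1 ≤ k → k ≤ n →
    (∏ j ∈ Finset.Ico (n - k) n, |deriv f (f^[j] x)|⁻¹) ≤ σ ^ k ∧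
    σ ^ (c * (k : ℝ)) ≤ truncDist δ (f^[n - k] x)

/-- A full branch Gibbs-Markov induced map of `f : [-1, 1] \ {0} → [-1, 1]` obtained from
hyperbolic times: an open interval `X` around `0`, a countable partition (modulo a Lebesgue null
set) of `X` into intervals, and an inducing time `τ`, constant on the partition elements,
such that `f^τ` maps each partition element onto `X` as a `C²` diffeomorphism, with uniform
expansion and uniformly bounded distortion, and such that `τ` is the sum of a
hyperbolic time and an integer between `0` and `N`. -/
structure HyperbolicInducing (f : ℝ → ℝ) where
  (left right : ℝ)
  left_mem : left ∈ Ico (-1 : ℝ) 0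
  right_mem : right ∈ Ioc (0 : ℝ) 1
  /-- The partition. -/
  part : Set (Set ℝ)
  part_countable : part.Countable
  part_disjoint : part.PairwiseDisjoint id
  part_interval : ∀ Q ∈ part, ∃ p q, p < q ∧ Q = Ioo p q
  part_subset : ∀ Q ∈ part, Q ⊆ Ioo left right
  part_full : volume (Ioo left right \ ⋃₀ part) = 0
  /-- The inducing time. -/
  τ : ℝ → ℕ
  τ_pos : ∀ Q ∈ part, ∀ x ∈ Q, 1 ≤ τ x
  τ_const : ∀ Q ∈ part, ∀ x ∈ Q, ∀ y ∈ Q, τ x = τ y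
  /-- `f^τ` is defined on each partition element: the orbit does not meet the singularity
  before time `τ`. -/
  orbit_ne_zero : ∀ Q ∈ part, ∀ x ∈ Q, ∀ j < τ x, f^[j] x ≠ 0
  full_branch : ∀ Q ∈ part, BijOn (fun x => f^[τ x] x) Q (Ioo left right)
  smooth : ∀ Q ∈ part, ContDiffOn ℝ 2 (fun x => f^[τ x] x) Q
  expanding : ∃ ρ > (1 : ℝ), ∀ Q ∈ part, ∀ x ∈ Q, ρ ≤ |deriv (fun x => f^[τ x] x) x|
  distortion : ∃ K α : ℝ, 0 < α ∧ ∀ Q ∈ part, ∀ x ∈ Q, ∀ y ∈ Q,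
    |Real.log (|deriv (fun x => f^[τ x] x) x| / |deriv (fun x => f^[τ x] x) y|)| ≤
      K * |f^[τ x] x - f^[τ y] y| ^ α
  hyperbolic_times : ∃ σ δ c : ℝ, ∃ N : ℕ, 0 < σ ∧ σ < 1 ∧ 0 < δ ∧ 0 < c ∧ c ≤ 1 / 2 ∧
    ∀ Q ∈ part, ∀ x ∈ Q, ∃ n k : ℕ, 1 ≤ n ∧ k ≤ N ∧ τ x = n + k ∧ IsHyperbolicTime f σ δ c n x

namespace HyperbolicInducing

variable {f : ℝ → ℝ}

/-- The domain of the induced map. -/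
def X (S : HyperbolicInducing f) : Set ℝ := Ioo S.left S.right

/-- The induced map. -/
def F (S : HyperbolicInducing f) (x : ℝ) : ℝ := f^[S.τ x] x

/-- The induced roof function of a roof function `r`. -/
def roof (S : HyperbolicInducing f) (r : ℝ → ℝ) (x : ℝ) : ℝ :=
  ∑ k ∈ Finset.range (S.τ x), r (f^[k] x)

/-- `h : X → Q` is an inverse branch of the induced map, for some partition element `Q`
(its values outside `X` are irrelevant). -/
def IsInverseBranch (S : HyperbolicInducing f) (h : ℝ → ℝ) : Prop :=
  ∃ Q ∈ S.part, MapsTo h S.X Q ∧ ∀ x ∈ S.X, S.F (h x) = x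

end HyperbolicInducing

end

/-! By the chain rule, with `y = h x`, the derivative of `R ∘ h` at `x` is the sum over `k < τ` of
`r'(f^k y)` divided by the product of `f'(f^i y)` over `k ≤ i < τ`. The roof derivative blows up at
the singularity, and the theorem says that backward contraction always beats this blow-up.

The saddle is integrated explicitly. In the coordinate `q = 2 (log z - log x)` the quantity `P(q) +
2 log x` is conserved, and the elapsed time is an integral of `E'`. The entry point `(x, 1)` has `q
= -2 log x`. Its exit coordinate `Ψ(q)` solves `P(Ψ q) = P q - q`, so `D = exp(Ψ/2)` and `T =
exp(-(P q - q)) (E q - E(Ψ q))`. `P` is linear up to a bounded error at both ends, which gives `Ψ(q)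
= -β q + O(1)`, hence `D' ≍ x^(β-1)`. `E` is bounded and `b₂/(a₂+b₂) = 1/(2β₂) < 1/4`, hence `T' =
O(x^(-3/2))`. These facts, with the regularity of `log D'` and the Hölder bound on `D`, form
`IsLorenzLike`; everything about the induced map uses only that structure.

Put `l = σ^(1/4)`. At distance `m` before time `τ - N`, the inverse product is `O(l^(4m))` and the
orbit is at distance at least a constant times `l^(2m)` from `0`, because `c ≤ 1/2`
(`exists_contraction`). So `|r'|` is `O(l^(-3m))`, the term is `O(l^m)`, and these terms sum
geometrically.

Hyperbolic times need not control the last `N` steps. There `exists_lower_bound_tail` keeps orbits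
away from `0`. Both `f^(τ-N)` and `f^τ` have bounded distortion on a branch, hence so does the block
between them. The branch at time `τ - N` has a definite size, since Hölder steps carry it to an
interval of definite length. So the block's derivative is bounded, and so is each of its factors; as
`|f'|` is large near `0`, the orbit cannot come close to `0`. -/

/-! ### The orbits of the neutral saddle -/

/-- A right inverse of a locally injective differentiable function is differentiable. -/
theorem HasStrictDerivAt.hasDerivAt_of_rightInverse {F g : ℝ → ℝ} {U : Set ℝ} {F' a x : ℝ}
    (hF : HasStrictDerivAt F F' a) (hF' : F' ≠ 0) (hU : U ∈ 𝓝 a) (hinj : InjOn F U)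
    (hx : F a = x) (hg : ∀ᶠ y in 𝓝 x, g y ∈ U ∧ F (g y) = y) : HasDerivAt g F'⁻¹ x := by
  subst hx
  have h1 := (hF.to_localInverse hF').hasDerivAt
  refine h1.congr_of_eventuallyEq ?_
  have h2 := hF.eventually_right_inverse hF'
  have h3 : ∀ᶠ y in 𝓝 (F a), hF.localInverse F F' a hF' y ∈ U := by
    have := h1.continuousAt.tendsto
    rw [show hF.localInverse F F' a hF' (F a) = a from
      (hF.eventually_left_inverse hF').self_of_nhds] at this
    exact this hU
  filter_upwards [h2, h3, hg] with y h2 h3 hg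
  exact hinj hg.1 h3 (by rw [hg.2, h2])

/-- The inverse of a strictly monotone differentiable function on the line. -/
theorem StrictMono.hasDerivAt_invFun {F : ℝ → ℝ} {F' a : ℝ} (hm : StrictMono F)
    (hF : HasStrictDerivAt F F' a) (hF' : F' ≠ 0) :
    HasDerivAt (Function.invFun F) F'⁻¹ (F a) := by
  refine hF.hasDerivAt_of_rightInverse hF' univ_mem hm.injective.injOn rfl ?_
  have : range F ∈ 𝓝 (F a) := by
    rw [← hF.map_nhds_eq hF']
    exact Filter.mem_map.2 (by simp)
  filter_upwards [this] with y hy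
  exact ⟨mem_univ _, Function.invFun_eq hy⟩

theorem HasDerivWithinAt.eq_left_of_zero {φ : ℝ → ℝ} {T : ℝ}
    (h : ∀ t ∈ Icc 0 T, HasDerivWithinAt φ 0 (Icc 0 T) t) {t : ℝ} (ht : t ∈ Icc 0 T) :
    φ t = φ 0 := by
  refine constant_of_has_deriv_right_zero (fun s hs => (h s hs).continuousWithinAt)
    (fun s hs => ?_) t ht
  exact (h s (Ico_subset_Icc_self hs)).mono_of_mem_nhdsWithin (Icc_mem_nhdsGE_of_mem hs)

/-- Solutions of a scalar linear equation keep their sign. -/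
theorem HasDerivWithinAt.pos_of_linear {X g : ℝ → ℝ} {T : ℝ} (hg : ContinuousOn g (Icc 0 T))
    (hX : ∀ t ∈ Icc 0 T, HasDerivWithinAt X (X t * g t) (Icc 0 T) t) (h0 : 0 < X 0) {t : ℝ}
    (ht : t ∈ Icc 0 T) : 0 < X t := by
  have hT : (0 : ℝ) ≤ T := ht.1.trans ht.2
  -- The coefficient is extended continuously to the whole line, so that the integrating factor `exp
  -- (-∫ g')` is differentiable at the endpoints too.
  set g' : ℝ → ℝ := IccExtend hT ((Icc 0 T).domRestrict g) with hg'
  have hc : Continuous g' := (continuousOn_iff_continuous_domRestrict.1 hg).Icc_extend'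
  have hG : ∀ s, HasDerivAt (fun s => ∫ u in (0 : ℝ)..s, g' u) (g' s) s := fun s =>
    intervalIntegral.integral_hasDerivAt_right (hc.intervalIntegrable _ _)
      (hc.stronglyMeasurableAtFilter _ _) hc.continuousAt
  have key : ∀ s ∈ Icc 0 T, HasDerivWithinAt
      (fun s => X s * Real.exp (-∫ u in (0 : ℝ)..s, g' u)) 0 (Icc 0 T) s := by
    intro s hs
    have h1 := (hX s hs).mul (((hG s).neg.exp).hasDerivWithinAt (s := Icc 0 T))
    have h2 : g' s = g s := by rw [hg', IccExtend_of_mem _ _ hs]; rfl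
    refine h1.congr_deriv ?_
    simp only [Pi.neg_apply, h2]
    ring
  have h3 := HasDerivWithinAt.eq_left_of_zero key ht
  simp only [intervalIntegral.integral_same, neg_zero, Real.exp_zero, mul_one] at h3
  rw [← h3] at h0
  exact pos_of_mul_pos_left h0 (Real.exp_pos _).le

/-- The first integral of the saddle is `saddleP q + 2 log x` in the coordinate
`q = 2 (log z - log x)`. -/
noncomputable def saddleP (a₀ a₂ b₀ b₂ q : ℝ) : ℝ :=
  a₀ / (a₀ + b₀) * q
    + (a₂ / (a₂ + b₂) - a₀ / (a₀ + b₀)) * Real.log ((a₀ + b₀) + (a₂ + b₂) * Real.exp q)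

/-- The integrand of the elapsed time in the coordinate `q`. -/
noncomputable def saddleE' (a₀ a₂ b₀ b₂ q : ℝ) : ℝ :=
  Real.exp (saddleP a₀ a₂ b₀ b₂ q) / (2 * ((a₀ + b₀) + (a₂ + b₂) * Real.exp q))

/-- The elapsed time, up to normalisation, in the coordinate `q`. -/
noncomputable def saddleE (a₀ a₂ b₀ b₂ q : ℝ) : ℝ := ∫ u in (0 : ℝ)..q, saddleE' a₀ a₂ b₀ b₂ u

/-- The logarithmic derivative of `x` along orbits, in the coordinate `q`. -/
noncomputable def saddleP' (a₀ a₂ b₀ b₂ q : ℝ) : ℝ :=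
  (a₀ + a₂ * Real.exp q) / ((a₀ + b₀) + (a₂ + b₂) * Real.exp q)

section Saddle

variable {a₀ a₂ b₀ b₂ : ℝ}

theorem hasDerivAt_saddleP (ha₀ : 0 < a₀) (ha₂ : 0 < a₂) (hb₀ : 0 < b₀) (hb₂ : 0 < b₂) (q : ℝ) :
    HasDerivAt (saddleP a₀ a₂ b₀ b₂) (saddleP' a₀ a₂ b₀ b₂ q) q := by
  have he := Real.exp_pos q
  have h0 : (a₀ + b₀) + (a₂ + b₂) * Real.exp q ≠ 0 := by positivity
  have h1 : HasDerivAt (fun q => (a₀ + b₀) + (a₂ + b₂) * Real.exp q)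
      ((a₂ + b₂) * Real.exp q) q := ((Real.hasDerivAt_exp q).const_mul _).const_add _
  have h2 := ((hasDerivAt_id q).const_mul (a₀ / (a₀ + b₀))).add
    ((h1.log h0).const_mul (a₂ / (a₂ + b₂) - a₀ / (a₀ + b₀)))
  refine h2.congr_deriv ?_
  have : a₀ + b₀ ≠ 0 := by positivity
  have : a₂ + b₂ ≠ 0 := by positivity
  unfold saddleP'
  field_simp
  ring

theorem continuous_saddleP (ha₀ : 0 < a₀) (ha₂ : 0 < a₂) (hb₀ : 0 < b₀) (hb₂ : 0 < b₂) :
    Continuous (saddleP a₀ a₂ b₀ b₂) :=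
  continuous_iff_continuousAt.2 fun q => (hasDerivAt_saddleP ha₀ ha₂ hb₀ hb₂ q).continuousAt

theorem continuous_saddleP' (ha₀ : 0 < a₀) (ha₂ : 0 < a₂) (hb₀ : 0 < b₀) (hb₂ : 0 < b₂) :
    Continuous (saddleP' a₀ a₂ b₀ b₂) := by
  unfold saddleP'
  exact Continuous.div (by fun_prop) (by fun_prop) fun q => by positivity

theorem continuous_saddleE' (ha₀ : 0 < a₀) (ha₂ : 0 < a₂) (hb₀ : 0 < b₀) (hb₂ : 0 < b₂) :
    Continuous (saddleE' a₀ a₂ b₀ b₂) := by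
  unfold saddleE'
  exact Continuous.div (Real.continuous_exp.comp (continuous_saddleP ha₀ ha₂ hb₀ hb₂))
    (by fun_prop) fun q => by positivity

theorem saddleE'_pos (ha₀ : 0 < a₀) (ha₂ : 0 < a₂) (hb₀ : 0 < b₀) (hb₂ : 0 < b₂) (q : ℝ) :
    0 < saddleE' a₀ a₂ b₀ b₂ q := by unfold saddleE'; positivity

theorem hasStrictDerivAt_saddleE (ha₀ : 0 < a₀) (ha₂ : 0 < a₂) (hb₀ : 0 < b₀) (hb₂ : 0 < b₂)
    (q : ℝ) : HasStrictDerivAt (saddleE a₀ a₂ b₀ b₂) (saddleE' a₀ a₂ b₀ b₂ q) q :=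
  have hc := continuous_saddleE' ha₀ ha₂ hb₀ hb₂
  intervalIntegral.integral_hasStrictDerivAt_right (hc.intervalIntegrable _ _)
    (hc.stronglyMeasurableAtFilter _ _) hc.continuousAt

theorem hasStrictDerivAt_saddleP (ha₀ : 0 < a₀) (ha₂ : 0 < a₂) (hb₀ : 0 < b₀) (hb₂ : 0 < b₂)
    (q : ℝ) : HasStrictDerivAt (saddleP a₀ a₂ b₀ b₂) (saddleP' a₀ a₂ b₀ b₂ q) q :=
  hasStrictDerivAt_of_hasDerivAt_of_continuousAt
    (Eventually.of_forall (hasDerivAt_saddleP ha₀ ha₂ hb₀ hb₂))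
    (continuous_saddleP' ha₀ ha₂ hb₀ hb₂).continuousAt

theorem saddleP'_pos (ha₀ : 0 < a₀) (ha₂ : 0 < a₂) (hb₀ : 0 < b₀) (hb₂ : 0 < b₂) (q : ℝ) :
    0 < saddleP' a₀ a₂ b₀ b₂ q := by unfold saddleP'; positivity

theorem strictMono_saddleE (ha₀ : 0 < a₀) (ha₂ : 0 < a₂) (hb₀ : 0 < b₀) (hb₂ : 0 < b₂) :
    StrictMono (saddleE a₀ a₂ b₀ b₂) :=
  strictMono_of_hasDerivAt_pos
    (fun q => (hasStrictDerivAt_saddleE ha₀ ha₂ hb₀ hb₂ q).hasDerivAt)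
    (saddleE'_pos ha₀ ha₂ hb₀ hb₂)

theorem strictMono_saddleP (ha₀ : 0 < a₀) (ha₂ : 0 < a₂) (hb₀ : 0 < b₀) (hb₂ : 0 < b₂) :
    StrictMono (saddleP a₀ a₂ b₀ b₂) :=
  strictMono_of_hasDerivAt_pos (hasDerivAt_saddleP ha₀ ha₂ hb₀ hb₂)
    (saddleP'_pos ha₀ ha₂ hb₀ hb₂)

/-- The two conserved quantities along an orbit. -/
theorem IsDulacOrbit.conserved (ha₀ : 0 < a₀) (ha₂ : 0 < a₂) (hb₀ : 0 < b₀) (hb₂ : 0 < b₂)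
    {x T w : ℝ} {γ : ℝ → ℝ × ℝ} (hx : 0 < x) (h : IsDulacOrbit a₀ a₂ b₀ b₂ x T w γ) :
    0 < w ∧
    saddleP a₀ a₂ b₀ b₂ (2 * Real.log w)
      = saddleP a₀ a₂ b₀ b₂ (-(2 * Real.log x)) + 2 * Real.log x ∧
    saddleE a₀ a₂ b₀ b₂ (2 * Real.log w)
        + T * Real.exp (saddleP a₀ a₂ b₀ b₂ (-(2 * Real.log x)) + 2 * Real.log x)
      = saddleE a₀ a₂ b₀ b₂ (-(2 * Real.log x)) := by
  set X : ℝ → ℝ := fun t => (γ t).1 with hXdef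
  set Z : ℝ → ℝ := fun t => (γ t).2 with hZdef
  have hT := h.time_nonneg
  have hX : ∀ t ∈ Icc 0 T, HasDerivWithinAt X (X t * (a₀ * X t ^ 2 + a₂ * Z t ^ 2)) (Icc 0 T) t :=
    fun t ht => (h.solves t ht).fst
  have hZ : ∀ t ∈ Icc 0 T,
      HasDerivWithinAt Z (Z t * (-(b₀ * X t ^ 2 + b₂ * Z t ^ 2))) (Icc 0 T) t := fun t ht => by
    have := (h.solves t ht).snd
    rw [mul_neg]
    exact this
  have hXc : ContinuousOn X (Icc 0 T) := fun t ht => (hX t ht).continuousWithinAt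
  have hZc : ContinuousOn Z (Icc 0 T) := fun t ht => (hZ t ht).continuousWithinAt
  have hX0 : X 0 = x := by simp [hXdef, h.start]
  have hZ0 : Z 0 = 1 := by simp [hZdef, h.start]
  have hXT : X T = 1 := by simp [hXdef, h.exit]
  have hZT : Z T = w := by simp [hZdef, h.exit]
  have hXp : ∀ t ∈ Icc 0 T, 0 < X t := fun t ht =>
    HasDerivWithinAt.pos_of_linear (by fun_prop) hX (by rw [hX0]; exact hx) ht
  have hZp : ∀ t ∈ Icc 0 T, 0 < Z t := fun t ht =>
    HasDerivWithinAt.pos_of_linear (by fun_prop) hZ (by rw [hZ0]; exact one_pos) ht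
  set q : ℝ → ℝ := fun t => 2 * (Real.log (Z t) - Real.log (X t)) with hq
  have heq : ∀ t ∈ Icc 0 T, X t ^ 2 * Real.exp (q t) = Z t ^ 2 := fun t ht => by
    have h1 := hXp t ht
    have h2 := hZp t ht
    simp only [hq]
    rw [← Real.log_div h2.ne' h1.ne', show (2 : ℝ) * Real.log (Z t / X t)
      = Real.log ((Z t / X t) ^ 2) by rw [Real.log_pow]; norm_num, Real.exp_log (by positivity)]
    field_simp
  have hqd : ∀ t ∈ Icc 0 T, HasDerivWithinAt q
      (-(2 * X t ^ 2 * ((a₀ + b₀) + (a₂ + b₂) * Real.exp (q t)))) (Icc 0 T) t := fun t ht => by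
    have h1 := hXp t ht
    have h2 := hZp t ht
    refine ((((hZ t ht).log h2.ne').sub ((hX t ht).log h1.ne')).const_mul 2).congr_deriv ?_
    rw [mul_div_cancel_left₀ _ h1.ne', mul_div_cancel_left₀ _ h2.ne']
    linear_combination (2 * (a₂ + b₂)) * heq t ht
  have hc : ∀ t ∈ Icc 0 T, HasDerivWithinAt
      (fun t => saddleP a₀ a₂ b₀ b₂ (q t) + 2 * Real.log (X t)) 0 (Icc 0 T) t := fun t ht => by
    have h1 := hXp t ht
    refine (((hasDerivAt_saddleP ha₀ ha₂ hb₀ hb₂ (q t)).comp_hasDerivWithinAt t (hqd t ht)).add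
      (((hX t ht).log h1.ne').const_mul 2)).congr_deriv ?_
    rw [mul_div_cancel_left₀ _ h1.ne', ← heq t ht]
    have : (a₀ + b₀) + (a₂ + b₂) * Real.exp (q t) ≠ 0 := by positivity
    unfold saddleP'
    field_simp
    ring
  have hcc : ∀ t ∈ Icc 0 T, saddleP a₀ a₂ b₀ b₂ (q t) + 2 * Real.log (X t)
      = saddleP a₀ a₂ b₀ b₂ (-(2 * Real.log x)) + 2 * Real.log x := fun t ht => by
    have := HasDerivWithinAt.eq_left_of_zero hc ht
    rw [this, hq]
    simp [hX0, hZ0]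
  have hE : ∀ t ∈ Icc 0 T, HasDerivWithinAt (fun t => saddleE a₀ a₂ b₀ b₂ (q t)
      + t * Real.exp (saddleP a₀ a₂ b₀ b₂ (-(2 * Real.log x)) + 2 * Real.log x)) 0
      (Icc 0 T) t := fun t ht => by
    have h1 := hXp t ht
    refine (((hasStrictDerivAt_saddleE ha₀ ha₂ hb₀ hb₂ (q t)).hasDerivAt.comp_hasDerivWithinAt t
      (hqd t ht)).add ((hasDerivWithinAt_id t _).mul_const _)).congr_deriv ?_
    rw [← hcc t ht, Real.exp_add, show (2 : ℝ) * Real.log (X t)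
      = Real.log (X t ^ 2) by rw [Real.log_pow]; norm_num, Real.exp_log (by positivity)]
    have : (a₀ + b₀) + (a₂ + b₂) * Real.exp (q t) ≠ 0 := by positivity
    unfold saddleE'
    field_simp
    ring
  have hTm : T ∈ Icc 0 T := ⟨hT, le_rfl⟩
  have hqT : q T = 2 * Real.log w := by simp [hq, hXT, hZT]
  refine ⟨hZT ▸ hZp T hTm, ?_, ?_⟩
  · have := hcc T hTm
    rw [hqT, hXT] at this
    simpa using this
  · have := HasDerivWithinAt.eq_left_of_zero hE hTm
    simp only [hqT] at this
    rw [this, hq]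
    simp [hX0, hZ0]

/-- Existence of the orbit which connects two points on the same level of the first integral. -/
theorem exists_isDulacOrbit (ha₀ : 0 < a₀) (ha₂ : 0 < a₂) (hb₀ : 0 < b₀) (hb₂ : 0 < b₂)
    {q₀ q₁ : ℝ} (hle : q₁ ≤ q₀)
    (hq : saddleP a₀ a₂ b₀ b₂ q₁ = saddleP a₀ a₂ b₀ b₂ q₀ - q₀) :
    ∃ γ, IsDulacOrbit a₀ a₂ b₀ b₂ (Real.exp (-(q₀ / 2)))
      (Real.exp (-saddleP a₀ a₂ b₀ b₂ q₁) * (saddleE a₀ a₂ b₀ b₂ q₀ - saddleE a₀ a₂ b₀ b₂ q₁))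
      (Real.exp (q₁ / 2)) γ := by
  set E := saddleE a₀ a₂ b₀ b₂ with hEdef
  set P := saddleP a₀ a₂ b₀ b₂ with hPdef
  have hEm : StrictMono E := strictMono_saddleE ha₀ ha₂ hb₀ hb₂
  have hEc : Continuous E := continuous_iff_continuousAt.2 fun q =>
    (hasStrictDerivAt_saddleE ha₀ ha₂ hb₀ hb₂ q).hasDerivAt.continuousAt
  set T := Real.exp (-P q₁) * (E q₀ - E q₁) with hTdef
  -- The two conserved quantities dictate the orbit: the time law determines `q`, then the first
  -- integral determines `X`, and `Z` follows from `z² = x² exp q`.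
  set q : ℝ → ℝ := fun t => Function.invFun E (E q₀ - t * Real.exp (P q₁)) with hqdef
  set X : ℝ → ℝ := fun t => Real.exp ((P q₁ - P (q t)) / 2) with hX
  set Z : ℝ → ℝ := fun t => X t * Real.exp (q t / 2) with hZ
  have hlinv : ∀ y, Function.invFun E (E y) = y := Function.leftInverse_invFun hEm.injective
  have hTe : T * Real.exp (P q₁) = E q₀ - E q₁ := by
    rw [hTdef, mul_right_comm, ← Real.exp_add]; simp
  have hq0 : q 0 = q₀ := by simp [hqdef, hlinv]
  have hqT : q T = q₁ := by simp [hqdef, hTe, hlinv]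
  have hex : ∀ t ∈ Icc 0 T, ∃ y, E y = E q₀ - t * Real.exp (P q₁) := fun t ht => by
    have h1 : t * Real.exp (P q₁) ≤ E q₀ - E q₁ := by
      rw [← hTe]; exact mul_le_mul_of_nonneg_right ht.2 (Real.exp_pos _).le
    have h2 : 0 ≤ t * Real.exp (P q₁) := mul_nonneg ht.1 (Real.exp_pos _).le
    obtain ⟨y, -, hy⟩ := intermediate_value_Icc hle hEc.continuousOn
      (show E q₀ - t * Real.exp (P q₁) ∈ Icc (E q₁) (E q₀) from ⟨by linarith, by linarith⟩)
    exact ⟨y, hy⟩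
  have hqd : ∀ t ∈ Icc 0 T, HasDerivAt q
      (-(2 * X t ^ 2 * ((a₀ + b₀) + (a₂ + b₂) * Real.exp (q t)))) t := fun t ht => by
    obtain ⟨y, hy⟩ := hex t ht
    have hqt : q t = y := by rw [hqdef]; simp only []; rw [← hy, hlinv]
    have h1 := hEm.hasDerivAt_invFun (hasStrictDerivAt_saddleE ha₀ ha₂ hb₀ hb₂ y)
      (saddleE'_pos ha₀ ha₂ hb₀ hb₂ y).ne'
    rw [hy] at h1
    have h2 : HasDerivAt (fun t => E q₀ - t * Real.exp (P q₁)) (-(1 * Real.exp (P q₁))) t :=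
      ((hasDerivAt_id t).mul_const _).const_sub _
    refine (h1.comp t h2).congr_deriv ?_
    have hX2 : X t ^ 2 = Real.exp (P q₁) / Real.exp (P y) := by
      rw [hX, ← Real.exp_nat_mul, ← Real.exp_sub, hqt]
      congr 1; push_cast; ring
    have : (a₀ + b₀) + (a₂ + b₂) * Real.exp y ≠ 0 := by positivity
    rw [hX2, hqt]
    unfold saddleE'
    field_simp
    rfl
  have hZ2 : ∀ t, Z t ^ 2 = X t ^ 2 * Real.exp (q t) := fun t => by
    simp only [hZ]
    rw [mul_pow, ← Real.exp_nat_mul (q t / 2) 2, Nat.cast_ofNat,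
      mul_div_cancel₀ (q t) two_ne_zero]
  have hXd : ∀ t ∈ Icc 0 T, HasDerivAt X (X t * (a₀ * X t ^ 2 + a₂ * Z t ^ 2)) t := fun t ht => by
    refine ((((hasDerivAt_saddleP ha₀ ha₂ hb₀ hb₂ (q t)).comp t (hqd t ht)).const_sub
      (P q₁)).div_const 2).exp.congr_deriv ?_
    have : (a₀ + b₀) + (a₂ + b₂) * Real.exp (q t) ≠ 0 := by positivity
    rw [hZ2]
    change X t * _ = _
    unfold saddleP'
    field_simp
  have hZd : ∀ t ∈ Icc 0 T, HasDerivAt Z (-(Z t * (b₀ * X t ^ 2 + b₂ * Z t ^ 2))) t :=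
    fun t ht => by
      refine ((hXd t ht).mul (((hqd t ht).div_const 2).exp)).congr_deriv ?_
      rw [hZ2]
      simp only [hZ]
      ring
  refine ⟨fun t => (X t, Z t), ⟨?_, ?_, fun t ht => ?_, ?_⟩⟩
  · exact mul_nonneg (Real.exp_pos _).le (sub_nonneg.2 (hEm.monotone hle))
  · simp only [hZ, hX, hq0, hq, Prod.mk.injEq]
    have : Real.exp ((P q₀ - q₀ - P q₀) / 2) = Real.exp (-(q₀ / 2)) := by congr 1; ring
    rw [this, ← Real.exp_add]
    simp
  · exact ((hXd t ht).prodMk (hZd t ht)).hasDerivWithinAt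
  · simp [hZ, hX, hqT]

end Saddle

/-! ### Asymptotics of the Dulac map and the Dulac time -/

/-- Comparison with the primitive `C / l * (1 - exp (-l s))` of the bound, which never exceeds `C /
l`. -/
theorem abs_sub_le_of_abs_deriv_le_exp {φ φ' : ℝ → ℝ} {C l : ℝ} (hl : 0 < l) (hC : 0 ≤ C)
    (hφ : ∀ q, HasDerivAt φ (φ' q) q) (hb : ∀ q, 0 ≤ q → |φ' q| ≤ C * Real.exp (-(l * q)))
    {q : ℝ} (hq : 0 ≤ q) : |φ q - φ 0| ≤ C / l := by
  have hB : ∀ s, HasDerivAt (fun s => C / l * (1 - Real.exp (-(l * s))))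
      (C * Real.exp (-(l * s))) s := fun s => by
    refine ((((hasDerivAt_id s).const_mul l).neg.exp.const_sub 1).const_mul (C / l)).congr_deriv ?_
    simp only [Pi.neg_apply, id]
    field_simp
  have h := image_norm_le_of_norm_deriv_right_le_deriv_boundary (f := fun s => φ s - φ 0)
    (f' := φ') (a := 0) (b := q)
    (fun s _ => ((hφ s).sub_const _).continuousAt.continuousWithinAt)
    (fun s _ => ((hφ s).sub_const _).hasDerivWithinAt) (by simp) hB
    (fun s hs => hb s hs.1) (right_mem_Icc.2 hq)
  rw [Real.norm_eq_abs] at h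
  refine h.trans (mul_le_of_le_one_right (by positivity) ?_)
  linarith [Real.exp_pos (-(l * q))]

theorem abs_le_of_mem_Icc_abs {x l u : ℝ} (hl : l ≤ x) (hu : x ≤ u) : |x| ≤ |l| + |u| :=
  abs_le.2 ⟨by linarith [neg_abs_le l, abs_nonneg u], by linarith [le_abs_self u, abs_nonneg l]⟩

/-- The derivative `v e^s / (u + v e^s)` lies in `[0, 1]`, whatever the positive coefficients are.
-/
theorem abs_log_add_mul_exp_sub_le {u v : ℝ} (hu : 0 < u) (hv : 0 < v) (p q : ℝ) :
    |Real.log (u + v * Real.exp p) - Real.log (u + v * Real.exp q)| ≤ |p - q| := by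
  have hd : ∀ s ∈ (univ : Set ℝ), HasDerivWithinAt (fun s => Real.log (u + v * Real.exp s))
      (v * Real.exp s / (u + v * Real.exp s)) univ s := fun s _ =>
    (((Real.hasDerivAt_exp s).const_mul v).const_add u |>.log (by positivity)).hasDerivWithinAt
  have := convex_univ.norm_image_sub_le_of_norm_hasDerivWithin_le (C := 1) hd (fun s _ => by
    rw [Real.norm_eq_abs, abs_of_nonneg (by positivity), div_le_one (by positivity)]
    linarith) (mem_univ q) (mem_univ p)
  simpa using this

/-! ### Entry-to-exit map and elapsed time in the coordinate `q` -/

namespace NeutralModel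

variable (M : NeutralModel)

/-- `saddleP` for the parameters of the model. -/
noncomputable def P (q : ℝ) : ℝ := saddleP M.a₀ M.a₂ M.b₀ M.b₂ q

/-- The derivative of `P`. -/
noncomputable def P' (q : ℝ) : ℝ := saddleP' M.a₀ M.a₂ M.b₀ M.b₂ q

/-- `saddleE` for the parameters of the model. -/
noncomputable def E (q : ℝ) : ℝ := saddleE M.a₀ M.a₂ M.b₀ M.b₂ q

/-- The derivative of `E`. -/
noncomputable def E' (q : ℝ) : ℝ := saddleE' M.a₀ M.a₂ M.b₀ M.b₂ q

/-- The exponent of the Dulac map. -/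
noncomputable def β : ℝ := ((M.a₀ + M.b₀) / (2 * M.a₀)) / ((M.a₂ + M.b₂) / (2 * M.b₂))

/-- The coordinate `q` of the exit point as a function of the coordinate of the entry point. -/
noncomputable def Ψ (q : ℝ) : ℝ := Function.invFun M.P (M.P q - q)

/-- Minus the derivative of `Ψ`. -/
noncomputable def κ (q : ℝ) : ℝ := (1 - M.P' q) / M.P' (M.Ψ q)

theorem hasDerivAt_P (q : ℝ) : HasDerivAt M.P (M.P' q) q :=
  hasDerivAt_saddleP M.a₀_pos M.a₂_pos M.b₀_pos M.b₂_pos q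

theorem hasStrictDerivAt_P (q : ℝ) : HasStrictDerivAt M.P (M.P' q) q :=
  hasStrictDerivAt_saddleP M.a₀_pos M.a₂_pos M.b₀_pos M.b₂_pos q

theorem P'_pos (q : ℝ) : 0 < M.P' q := saddleP'_pos M.a₀_pos M.a₂_pos M.b₀_pos M.b₂_pos q

theorem strictMono_P : StrictMono M.P := strictMono_saddleP M.a₀_pos M.a₂_pos M.b₀_pos M.b₂_pos

theorem hasDerivAt_E (q : ℝ) : HasDerivAt M.E (M.E' q) q :=
  (hasStrictDerivAt_saddleE M.a₀_pos M.a₂_pos M.b₀_pos M.b₂_pos q).hasDerivAt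

theorem one_sub_P' (q : ℝ) : 1 - M.P' q =
    (M.b₀ + M.b₂ * Real.exp q) / ((M.a₀ + M.b₀) + (M.a₂ + M.b₂) * Real.exp q) := by
  have := M.a₀_pos; have := M.a₂_pos; have := M.b₀_pos; have := M.b₂_pos
  have : (M.a₀ + M.b₀) + (M.a₂ + M.b₂) * Real.exp q ≠ 0 := by positivity
  unfold P' saddleP'
  field_simp
  ring

/-- Both quantities are mediants: weighted averages of their limits at `-∞` and `+∞`, which are
positive. -/
theorem exists_le_P' : ∃ m > 0, ∀ q, m ≤ M.P' q ∧ m ≤ 1 - M.P' q := by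
  have h1 := M.a₀_pos; have h2 := M.a₂_pos; have h3 := M.b₀_pos; have h4 := M.b₂_pos
  have key : ∀ u v m e : ℝ, 0 < e → m ≤ u / (M.a₀ + M.b₀) → m ≤ v / (M.a₂ + M.b₂) →
      m ≤ (u + v * e) / ((M.a₀ + M.b₀) + (M.a₂ + M.b₂) * e) := by
    intro u v m e he hu hv
    rw [le_div_iff₀ (by positivity)] at *
    nlinarith
  set m₁ := min (M.a₀ / (M.a₀ + M.b₀)) (M.a₂ / (M.a₂ + M.b₂)) with hm₁
  set m₂ := min (M.b₀ / (M.a₀ + M.b₀)) (M.b₂ / (M.a₂ + M.b₂)) with hm₂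
  refine ⟨min m₁ m₂, by positivity, fun q => ⟨?_, ?_⟩⟩
  · exact key _ _ _ _ (Real.exp_pos q) ((min_le_left _ _).trans (min_le_left _ _))
      ((min_le_left _ _).trans (min_le_right _ _))
  · rw [one_sub_P']
    exact key _ _ _ _ (Real.exp_pos q) ((min_le_right _ _).trans (min_le_left _ _))
      ((min_le_right _ _).trans (min_le_right _ _))

theorem surjective_P : Function.Surjective M.P := by
  obtain ⟨m, hm, h⟩ := M.exists_le_P'
  have hmono : Monotone fun q => M.P q - m * q := monotone_of_hasDerivAt_nonneg
    (fun q => (M.hasDerivAt_P q).sub ((hasDerivAt_id q).const_mul m))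
    (fun q => by have := (h q).1; simp only [Pi.zero_apply]; linarith)
  refine (continuous_iff_continuousAt.2 fun q => (M.hasDerivAt_P q).continuousAt).surjective ?_ ?_
  · refine tendsto_atTop_mono' _ ((eventually_ge_atTop 0).mono fun q hq => ?_)
      (tendsto_atTop_add_const_left _ (M.P 0) (tendsto_id.const_mul_atTop hm))
    have := hmono hq
    simp only [id] at *
    linarith
  · refine tendsto_atBot_mono' _ ((eventually_le_atBot 0).mono fun q hq => ?_)
      (tendsto_atBot_add_const_left _ (M.P 0) (tendsto_id.const_mul_atBot hm))
    have := hmono hq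
    simp only [id] at *
    linarith

theorem P_Ψ (q : ℝ) : M.P (M.Ψ q) = M.P q - q := Function.invFun_eq (M.surjective_P _)

theorem Ψ_lt_zero {q : ℝ} (hq : 0 < q) : M.Ψ q < 0 := by
  have hanti : StrictAnti fun q => M.P q - q := strictAnti_of_hasDerivAt_neg
    (fun q => (M.hasDerivAt_P q).sub (hasDerivAt_id q)) fun q => by
      obtain ⟨m, hm, h⟩ := M.exists_le_P'
      linarith [(h q).2]
  have h1 := hanti hq
  simp only [sub_zero] at h1
  rw [← P_Ψ] at h1
  exact M.strictMono_P.lt_iff_lt.1 h1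

theorem hasDerivAt_Ψ (q : ℝ) : HasDerivAt M.Ψ (-M.κ q) q := by
  have h1 := M.strictMono_P.hasDerivAt_invFun (M.hasStrictDerivAt_P (M.Ψ q)) (M.P'_pos _).ne'
  rw [P_Ψ] at h1
  refine (HasDerivAt.comp (h := fun q => M.P q - q) q h1
    ((M.hasDerivAt_P q).sub (hasDerivAt_id q))).congr_deriv ?_
  unfold κ
  field_simp
  ring

theorem κ_bounds : ∃ m > 0, ∃ C, ∀ q, m ≤ M.κ q ∧ M.κ q ≤ C := by
  obtain ⟨m, hm, h⟩ := M.exists_le_P'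
  refine ⟨m, hm, 1 / m, fun q => ⟨?_, ?_⟩⟩
  · rw [κ, le_div_iff₀ (M.P'_pos _)]
    have h1 := (h q).2
    have h2 := (h (M.Ψ q)).2
    nlinarith [M.P'_pos (M.Ψ q)]
  · unfold κ
    have h1 := M.P'_pos q
    exact div_le_div₀ zero_le_one (by linarith) hm (h _).1

/-- `log κ` is a signed sum of four functions `log (u + v exp ·)`, two at `q` and two at `Ψ q`. Each
is 1-Lipschitz and `Ψ` is Lipschitz because `κ` is bounded. -/
theorem lipschitz_log_κ : ∃ C, 0 ≤ C ∧ ∀ p q,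
    |Real.log (M.κ p) - Real.log (M.κ q)| ≤ C * |p - q| ∧ |M.Ψ p - M.Ψ q| ≤ C * |p - q| := by
  have ha₀ := M.a₀_pos; have ha₂ := M.a₂_pos; have hb₀ := M.b₀_pos; have hb₂ := M.b₂_pos
  obtain ⟨m, hm, K, hK⟩ := M.κ_bounds
  have hK0 : 0 < K := hm.trans_le ((hK 0).1.trans (hK 0).2)
  have hΨ : ∀ p q, |M.Ψ p - M.Ψ q| ≤ K * |p - q| := fun p q =>
    convex_univ.norm_image_sub_le_of_norm_hasDerivWithin_le
      (fun s _ => (M.hasDerivAt_Ψ s).hasDerivWithinAt) (fun s _ => by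
        rw [norm_neg, Real.norm_eq_abs, abs_of_nonneg (hm.le.trans (hK s).1)]
        exact (hK s).2) (mem_univ q) (mem_univ p)
  have hlog : ∀ q, Real.log (M.κ q) = Real.log (M.b₀ + M.b₂ * Real.exp q)
      - Real.log ((M.a₀ + M.b₀) + (M.a₂ + M.b₂) * Real.exp q)
      - (Real.log (M.a₀ + M.a₂ * Real.exp (M.Ψ q))
      - Real.log ((M.a₀ + M.b₀) + (M.a₂ + M.b₂) * Real.exp (M.Ψ q))) := fun q => by
    rw [κ, one_sub_P', P', saddleP', Real.log_div (by positivity) (by positivity),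
      Real.log_div (by positivity) (by positivity), Real.log_div (by positivity) (by positivity)]
  refine ⟨2 + 2 * K, by positivity, fun p q => ⟨?_, (hΨ p q).trans ?_⟩⟩
  · have h1 := abs_le.1 (abs_log_add_mul_exp_sub_le hb₀ hb₂ p q)
    have h2 := abs_le.1 (abs_log_add_mul_exp_sub_le (add_pos ha₀ hb₀) (add_pos ha₂ hb₂) p q)
    have h3 := abs_le.1 (abs_log_add_mul_exp_sub_le ha₀ ha₂ (M.Ψ p) (M.Ψ q))
    have h4 := abs_le.1
      (abs_log_add_mul_exp_sub_le (add_pos ha₀ hb₀) (add_pos ha₂ hb₂) (M.Ψ p) (M.Ψ q))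
    have h5 := hΨ p q
    rw [hlog, hlog, abs_le]
    constructor <;> linarith
  · nlinarith [abs_nonneg (p - q)]

theorem log_bound_of_nonpos : ∃ C, 0 ≤ C ∧ ∀ q ≤ 0,
    |M.P q - M.a₀ / (M.a₀ + M.b₀) * q| ≤ C := by
  have ha₀ := M.a₀_pos; have ha₂ := M.a₂_pos; have hb₀ := M.b₀_pos; have hb₂ := M.b₂_pos
  refine ⟨|M.a₂ / (M.a₂ + M.b₂) - M.a₀ / (M.a₀ + M.b₀)| * (|Real.log (M.a₀ + M.b₀)|
    + |Real.log ((M.a₀ + M.b₀) + (M.a₂ + M.b₂))|), by positivity, fun q hq => ?_⟩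
  have he := Real.exp_pos q
  have he1 := Real.exp_le_one_iff.2 hq
  rw [P, saddleP, add_sub_cancel_left, abs_mul]
  refine mul_le_mul_of_nonneg_left (abs_le_of_mem_Icc_abs ?_ ?_) (abs_nonneg _)
  · exact Real.log_le_log (by positivity) (le_add_of_nonneg_right (by positivity))
  · refine Real.log_le_log (by positivity) ?_
    nlinarith

theorem log_bound_of_nonneg : ∃ C, 0 ≤ C ∧ ∀ q, 0 ≤ q →
    |M.P q - q + M.b₂ / (M.a₂ + M.b₂) * q| ≤ C := by
  have ha₀ := M.a₀_pos; have ha₂ := M.a₂_pos; have hb₀ := M.b₀_pos; have hb₂ := M.b₂_pos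
  refine ⟨|M.a₂ / (M.a₂ + M.b₂) - M.a₀ / (M.a₀ + M.b₀)| * (|Real.log (M.a₂ + M.b₂)|
    + |Real.log ((M.a₀ + M.b₀) + (M.a₂ + M.b₂))|), by positivity, fun q hq => ?_⟩
  have he := Real.exp_pos (-q)
  have he1 := Real.exp_le_one_iff.2 (neg_nonpos.2 hq)
  have h1 : Real.log ((M.a₀ + M.b₀) + (M.a₂ + M.b₂) * Real.exp q)
      = q + Real.log ((M.a₀ + M.b₀) * Real.exp (-q) + (M.a₂ + M.b₂)) := by
    rw [← Real.log_exp q, ← Real.log_mul (Real.exp_pos q).ne' (by positivity), Real.log_exp,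
      mul_add, mul_left_comm, ← Real.exp_add]
    simp [mul_comm]
  have h2 : M.P q - q + M.b₂ / (M.a₂ + M.b₂) * q
      = (M.a₂ / (M.a₂ + M.b₂) - M.a₀ / (M.a₀ + M.b₀))
        * Real.log ((M.a₀ + M.b₀) * Real.exp (-q) + (M.a₂ + M.b₂)) := by
    rw [P, saddleP, h1]
    field_simp
    ring
  rw [h2, abs_mul]
  refine mul_le_mul_of_nonneg_left (abs_le_of_mem_Icc_abs ?_ ?_) (abs_nonneg _)
  · exact Real.log_le_log (by positivity) (le_add_of_nonneg_left (by positivity))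
  · refine Real.log_le_log (by positivity) ?_
    nlinarith

/-- In `P (Ψ q) = P q - q` the left side is taken near `-∞`, with slope `a₀/(a₀+b₀)`, and the right
side near `+∞`, with slope `-b₂/(a₂+b₂)`. The ratio of the slopes is `-β`. -/
theorem Ψ_asymptotics : ∃ C, ∀ q, 0 < q → |M.Ψ q + M.β * q| ≤ C := by
  have ha₀ := M.a₀_pos; have ha₂ := M.a₂_pos; have hb₀ := M.b₀_pos; have hb₂ := M.b₂_pos
  obtain ⟨C₁, -, h₁⟩ := M.log_bound_of_nonpos
  obtain ⟨C₂, -, h₂⟩ := M.log_bound_of_nonneg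
  refine ⟨(M.a₀ + M.b₀) / M.a₀ * (C₁ + C₂), fun q hq => ?_⟩
  have h3 := abs_le.1 (h₁ _ (M.Ψ_lt_zero hq).le)
  have h4 := abs_le.1 (h₂ q hq.le)
  rw [P_Ψ] at h3
  have h5 : M.Ψ q + M.β * q = (M.a₀ + M.b₀) / M.a₀ *
      (M.a₀ / (M.a₀ + M.b₀) * M.Ψ q + M.b₂ / (M.a₂ + M.b₂) * q) := by
    unfold β
    field_simp
  rw [h5, abs_mul, abs_of_pos (by positivity)]
  refine mul_le_mul_of_nonneg_left (abs_le.2 ⟨?_, ?_⟩) (by positivity) <;> linarith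

/-- The integrand `E'` decays exponentially at both ends, at rates `b₂/(a₂+b₂)` and `a₀/(a₀+b₀)`. -/
theorem E_bounded : ∃ C, ∀ q, |M.E q| ≤ C := by
  have ha₀ := M.a₀_pos; have ha₂ := M.a₂_pos; have hb₀ := M.b₀_pos; have hb₂ := M.b₂_pos
  obtain ⟨C₁, -, h₁⟩ := M.log_bound_of_nonpos
  obtain ⟨C₂, -, h₂⟩ := M.log_bound_of_nonneg
  have hE0 : M.E 0 = 0 := by simp [E, saddleE]
  have hpos : ∀ q, 0 ≤ q → |M.E' q| ≤ Real.exp C₂ / (2 * (M.a₂ + M.b₂))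
      * Real.exp (-(M.b₂ / (M.a₂ + M.b₂) * q)) := fun q hq => by
    have h := (abs_le.1 (h₂ q hq)).2
    rw [E', abs_of_pos (saddleE'_pos ha₀ ha₂ hb₀ hb₂ q), saddleE', div_mul_eq_mul_div,
      ← Real.exp_add, div_le_div_iff₀ (by positivity) (by positivity)]
    calc Real.exp (M.P q) * (2 * (M.a₂ + M.b₂))
        ≤ Real.exp (C₂ + -(M.b₂ / (M.a₂ + M.b₂) * q) + q) * (2 * (M.a₂ + M.b₂)) := by
          gcongr; linarith
      _ = Real.exp (C₂ + -(M.b₂ / (M.a₂ + M.b₂) * q)) * (2 * ((M.a₂ + M.b₂) * Real.exp q)) := by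
          rw [Real.exp_add _ q]; ring
      _ ≤ _ := by
          gcongr
          exact le_add_of_nonneg_left (by positivity)
  have hneg : ∀ q, 0 ≤ q → |-M.E' (-q)| ≤ Real.exp C₁ / (2 * (M.a₀ + M.b₀))
      * Real.exp (-(M.a₀ / (M.a₀ + M.b₀) * q)) := fun q hq => by
    have h := (abs_le.1 (h₁ (-q) (neg_nonpos.2 hq))).2
    rw [abs_neg, E', abs_of_pos (saddleE'_pos ha₀ ha₂ hb₀ hb₂ _), saddleE', div_mul_eq_mul_div,
      ← Real.exp_add]
    refine div_le_div₀ (by positivity) (Real.exp_le_exp.2 ?_) (by positivity) ?_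
    · change M.P (-q) ≤ _; linarith
    · exact mul_le_mul_of_nonneg_left (le_add_of_nonneg_right (by positivity)) zero_le_two
  refine ⟨Real.exp C₂ / (2 * (M.a₂ + M.b₂)) / (M.b₂ / (M.a₂ + M.b₂))
    + Real.exp C₁ / (2 * (M.a₀ + M.b₀)) / (M.a₀ / (M.a₀ + M.b₀)), fun q => ?_⟩
  rcases le_total 0 q with hq | hq
  · have := abs_sub_le_of_abs_deriv_le_exp (by positivity) (by positivity) M.hasDerivAt_E hpos hq
    rw [hE0, sub_zero] at this
    exact this.trans (le_add_of_nonneg_right (by positivity))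
  · have := abs_sub_le_of_abs_deriv_le_exp (φ := fun q => M.E (-q)) (by positivity) (by positivity)
      (fun q => ((M.hasDerivAt_E (-q)).comp q (hasDerivAt_neg q)).congr_deriv (by simp)) hneg
      (neg_nonneg.2 hq)
    simp only [neg_neg, neg_zero, hE0, sub_zero] at this
    exact this.trans (le_add_of_nonneg_left (by positivity))

theorem β_pos : 0 < M.β := by
  have ha₀ := M.a₀_pos; have ha₂ := M.a₂_pos; have hb₀ := M.b₀_pos; have hb₂ := M.b₂_pos
  unfold β; positivity

theorem β_lt_one : M.β < 1 := by
  have ha₀ := M.a₀_pos; have ha₂ := M.a₂_pos; have hb₀ := M.b₀_pos; have hb₂ := M.b₂_pos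
  rw [β, div_lt_one (by positivity)]
  exact M.beta₀_lt_beta₂

/-- The Dulac time as a function of the coordinate `q` of the entry point. -/
noncomputable def timeQ (q : ℝ) : ℝ := Real.exp (-(M.P q - q)) * (M.E q - M.E (M.Ψ q))

/-- Only the derivative of the prefactor `exp (-(P q - q))` grows. In the two endpoint terms the
exponential cancels against the one in `E'`, and what remains is bounded. -/
theorem timeQ_deriv : ∃ C, 0 ≤ C ∧ ∀ q, 0 < q → ∃ d, HasDerivAt M.timeQ d q ∧
    |d| ≤ C * Real.exp (q / 4) := by
  have ha₀ := M.a₀_pos; have ha₂ := M.a₂_pos; have hb₀ := M.b₀_pos; have hb₂ := M.b₂_pos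
  obtain ⟨C₁, h₁⟩ := M.E_bounded
  obtain ⟨C₂, hC₂, h₂⟩ := M.log_bound_of_nonneg
  obtain ⟨m, hm, K, hK⟩ := M.κ_bounds
  have hK0 : 0 < K := hm.trans_le ((hK 0).1.trans (hK 0).2)
  have hC₁ : 0 ≤ C₁ := (abs_nonneg _).trans (h₁ 0)
  refine ⟨Real.exp C₂ * (2 * C₁) + 1 / (2 * (M.a₂ + M.b₂)) + 1 / (2 * (M.a₀ + M.b₀)) * K,
    by positivity, fun q hq => ?_⟩
  have hd : HasDerivAt M.timeQ (Real.exp (-(M.P q - q)) * (1 - M.P' q) * (M.E q - M.E (M.Ψ q))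
      + (Real.exp (-(M.P q - q)) * M.E' q + Real.exp (-(M.P q - q)) * M.E' (M.Ψ q) * M.κ q)) q := by
    refine ((((M.hasDerivAt_P q).sub (hasDerivAt_id q)).neg.exp).mul ((M.hasDerivAt_E q).sub
      ((M.hasDerivAt_E (M.Ψ q)).comp q (M.hasDerivAt_Ψ q)))).congr_deriv ?_
    simp only [Pi.neg_apply, Pi.sub_apply, id, Function.comp]
    ring
  refine ⟨_, hd, ?_⟩
  -- This is where `β₂ > 2` enters: the quotient equals `1 / (2 β₂)`.
  have hb : M.b₂ / (M.a₂ + M.b₂) ≤ 1 / 4 := by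
    have := M.two_lt_beta₂
    rw [lt_div_iff₀ (by positivity)] at this
    rw [div_le_div_iff₀ (by positivity) (by positivity)]
    linarith
  have hN : Real.exp (-(M.P q - q)) ≤ Real.exp C₂ * Real.exp (q / 4) := by
    rw [← Real.exp_add, Real.exp_le_exp]
    have := (abs_le.1 (h₂ q hq.le)).1
    nlinarith
  have hq1 : 1 ≤ Real.exp (q / 4) := Real.one_le_exp (by positivity)
  obtain ⟨m', hm', hP'⟩ := M.exists_le_P'
  have t1 : |Real.exp (-(M.P q - q)) * (1 - M.P' q) * (M.E q - M.E (M.Ψ q))|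
      ≤ Real.exp C₂ * (2 * C₁) * Real.exp (q / 4) := by
    rw [abs_mul, abs_mul, abs_of_pos (Real.exp_pos _)]
    have e1 : |1 - M.P' q| ≤ 1 := abs_le.2 ⟨by linarith [(hP' q).2], by linarith [M.P'_pos q]⟩
    have e2 : |M.E q - M.E (M.Ψ q)| ≤ 2 * C₁ := by
      have := abs_le.1 (h₁ q)
      have := abs_le.1 (h₁ (M.Ψ q))
      exact abs_le.2 ⟨by linarith, by linarith⟩
    calc _ ≤ Real.exp C₂ * Real.exp (q / 4) * 1 * (2 * C₁) := by gcongr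
      _ = _ := by ring
  have t2 : |Real.exp (-(M.P q - q)) * M.E' q| ≤ 1 / (2 * (M.a₂ + M.b₂)) := by
    have : Real.exp (-(M.P q - q)) * M.E' q
        = Real.exp q / (2 * ((M.a₀ + M.b₀) + (M.a₂ + M.b₂) * Real.exp q)) := by
      rw [E', saddleE', ← mul_div_assoc, ← Real.exp_add]
      congr 2
      change -(M.P q - q) + M.P q = q
      ring
    rw [this, abs_of_pos (by positivity), div_le_div_iff₀ (by positivity) (by positivity)]
    nlinarith [Real.exp_pos q]
  have t3 : |Real.exp (-(M.P q - q)) * M.E' (M.Ψ q) * M.κ q| ≤ 1 / (2 * (M.a₀ + M.b₀)) * K := by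
    have : Real.exp (-(M.P q - q)) * M.E' (M.Ψ q)
        = 1 / (2 * ((M.a₀ + M.b₀) + (M.a₂ + M.b₂) * Real.exp (M.Ψ q))) := by
      rw [← P_Ψ, E', saddleE', ← mul_div_assoc, ← Real.exp_add]
      congr 1
      change Real.exp (-(M.P (M.Ψ q)) + M.P (M.Ψ q)) = 1
      simp
    have hκ := hK q
    rw [this, abs_of_pos (mul_pos (by positivity) (hm.trans_le hκ.1))]
    refine mul_le_mul ?_ hκ.2 (hm.le.trans hκ.1) (by positivity)
    refine one_div_le_one_div_of_le (by positivity) ?_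
    nlinarith [mul_pos (add_pos ha₂ hb₂) (Real.exp_pos (M.Ψ q))]
  have t4 : (0 : ℝ) ≤ 1 / (2 * (M.a₂ + M.b₂)) := by positivity
  have t5 : (0 : ℝ) ≤ 1 / (2 * (M.a₀ + M.b₀)) * K := by positivity
  calc _ ≤ _ := (abs_add_le _ _).trans (add_le_add_right (abs_add_le _ _) _)
    _ ≤ Real.exp C₂ * (2 * C₁) * Real.exp (q / 4) +
      (1 / (2 * (M.a₂ + M.b₂)) + 1 / (2 * (M.a₀ + M.b₀)) * K) := by gcongr
    _ ≤ _ := by nlinarith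

/-- Existence of an orbit and the two conserved quantities make the sets of exit heights and of
times singletons, so each `sInf` is their only element. -/
theorem dulac_eq_and_dulacTime_eq {x : ℝ} (hx : 0 < x) (hx1 : x < 1) :
    M.dulac x = Real.exp (M.Ψ (-(2 * Real.log x)) / 2) ∧
    dulacTime M.a₀ M.a₂ M.b₀ M.b₂ x = M.timeQ (-(2 * Real.log x)) := by
  have ha₀ := M.a₀_pos; have ha₂ := M.a₂_pos; have hb₀ := M.b₀_pos; have hb₂ := M.b₂_pos
  set q := -(2 * Real.log x) with hq
  have hq0 : 0 < q := by have := Real.log_neg hx hx1; rw [hq]; linarith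
  obtain ⟨γ₀, h₀⟩ := exists_isDulacOrbit ha₀ ha₂ hb₀ hb₂
    ((M.Ψ_lt_zero hq0).le.trans hq0.le) (M.P_Ψ q)
  have hxq : Real.exp (-(q / 2)) = x := by
    rw [hq, show -(-(2 * Real.log x) / 2) = Real.log x by ring, Real.exp_log hx]
  rw [hxq] at h₀
  change IsDulacOrbit _ _ _ _ x (Real.exp (-M.P (M.Ψ q)) * (M.E q - M.E (M.Ψ q))) _ γ₀ at h₀
  rw [P_Ψ] at h₀
  change IsDulacOrbit _ _ _ _ x (M.timeQ q) _ γ₀ at h₀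
  have huniq : ∀ T w γ, IsDulacOrbit M.a₀ M.a₂ M.b₀ M.b₂ x T w γ →
      w = Real.exp (M.Ψ q / 2) ∧ T = M.timeQ q := by
    intro T w γ h
    obtain ⟨hw, h1, h2⟩ := h.conserved ha₀ ha₂ hb₀ hb₂ hx
    rw [← hq, show (2 : ℝ) * Real.log x = -q by rw [hq]; ring, ← sub_eq_add_neg] at h1 h2
    change M.P _ = M.P q - q at h1
    change M.E _ + T * Real.exp (M.P q - q) = M.E q at h2
    rw [← P_Ψ] at h1
    have h3 := M.strictMono_P.injective h1
    rw [h3] at h2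
    refine ⟨?_, ?_⟩
    · rw [← h3, mul_div_cancel_left₀ _ two_ne_zero, Real.exp_log hw]
    · rw [timeQ, ← h2, Real.exp_neg]
      field_simp
      ring
  constructor
  · have : {w | ∃ T γ, IsDulacOrbit M.a₀ M.a₂ M.b₀ M.b₂ x T w γ} = {Real.exp (M.Ψ q / 2)} :=
      eq_singleton_iff_unique_mem.2 ⟨⟨_, _, h₀⟩, fun w ⟨T, γ, h⟩ => (huniq T w γ h).1⟩
    rw [dulac, dulacMap, this, csInf_singleton]
  · have : {T | ∃ w γ, IsDulacOrbit M.a₀ M.a₂ M.b₀ M.b₂ x T w γ} = {M.timeQ q} :=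
      eq_singleton_iff_unique_mem.2 ⟨⟨_, _, h₀⟩, fun T ⟨w, γ, h⟩ => (huniq T w γ h).2⟩
    rw [dulacTime, this, csInf_singleton]

end NeutralModel

/-! ### Induced roof functions over Lorenz-like maps -/

/-- A map of `[-1, 1] \ {0}` with a singularity of order `β - 1` at `0`, together with a roof
function whose derivative blows up at most like `|x| ^ (-3 / 2)`. -/
structure IsLorenzLike (f r : ℝ → ℝ) (β C : ℝ) : Prop where
  β_pos : 0 < β
  β_lt_one : β < 1
  one_le : 1 ≤ C
  abs_lt_one : ∀ x, x ≠ 0 → |x| < 1 → |f x| < 1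
  differentiableAt : ∀ x, x ≠ 0 → |x| < 1 → DifferentiableAt ℝ f x
  lower : ∀ x, x ≠ 0 → |x| < 1 → |x| ^ (β - 1) ≤ C * |deriv f x|
  upper : ∀ x, x ≠ 0 → |x| < 1 → |deriv f x| ≤ C * |x| ^ (β - 1)
  log_lipschitz : ∀ x y, 0 < x * y → |x| < 1 → |y| < 1 →
    |Real.log (deriv f x) - Real.log (deriv f y)| ≤ C * |Real.log x - Real.log y|
  hoelder : ∀ x y, 0 < x * y → |x| < 1 → |y| < 1 → |f x - f y| ≤ C * |x - y| ^ β
  differentiableAt_roof : ∀ x, x ≠ 0 → |x| < 1 → DifferentiableAt ℝ r x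
  abs_deriv_roof_le : ∀ x, x ≠ 0 → |x| < 1 → |deriv r x| ≤ C * |x| ^ (-(3 / 2) : ℝ)

/-- No sign is needed because `Real.log` is even; this serves orbits on either side of `0`. -/
theorem abs_log_sub_log_le {a b m : ℝ} (hm : 0 < m) (ha : m ≤ |a|) (hb : m ≤ |b|) :
    |Real.log a - Real.log b| ≤ |a - b| / m := by
  have key : ∀ a b : ℝ, m ≤ |a| → m ≤ |b| → Real.log a - Real.log b ≤ |a - b| / m := by
    intro a b ha hb
    have ha' := hm.trans_le ha
    have hb' := hm.trans_le hb
    rw [← Real.log_abs a, ← Real.log_abs b, ← Real.log_div ha'.ne' hb'.ne']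
    refine (Real.log_le_sub_one_of_pos (div_pos ha' hb')).trans ?_
    rw [div_sub_one hb'.ne']
    exact div_le_div₀ (abs_nonneg _) (abs_sub_abs_le_abs_sub a b) hm hb
  refine abs_le.2 ⟨?_, key a b ha hb⟩
  have := key b a hb ha
  rw [abs_sub_comm] at this
  linarith

theorem sum_range_pow_sub_le {l : ℝ} (h0 : 0 < l) (h1 : l < 1) (n : ℕ) :
    ∑ j ∈ Finset.range n, l ^ (n - j) ≤ 1 / (1 - l) := by
  have h : ∑ j ∈ Finset.range n, l ^ (n - j) ≤ ∑ j ∈ Finset.range n, l ^ j := by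
    rw [← Finset.sum_range_reflect (fun j => l ^ j)]
    exact Finset.sum_le_sum fun j hj => pow_le_pow_of_le_one h0.le h1.le (by omega)
  refine h.trans ?_
  rw [geom_sum_eq h1.ne, ← neg_div_neg_eq, neg_sub, neg_sub]
  exact div_le_div_of_nonneg_right (by linarith [pow_pos h0 n]) (by linarith)

theorem prod_Ico_le_pow {u : ℕ → ℝ} {B : ℝ} {m n N : ℕ} (hB : 1 ≤ B) (hN : n - m ≤ N)
    (hu : ∀ i ∈ Finset.Ico m n, 0 ≤ u i ∧ u i ≤ B) : ∏ i ∈ Finset.Ico m n, u i ≤ B ^ N := by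
  refine (Finset.prod_le_prod (fun i hi => (hu i hi).1) fun i hi => (hu i hi).2).trans ?_
  rw [Finset.prod_const, Nat.card_Ico]
  exact pow_le_pow_right₀ hB hN

/-- Backward propagation of a lower bound through boundedly many Hölder steps. -/
theorem exists_lower_bound_of_hoelder {C β L : ℝ} (hC : 0 < C) (hβ : 0 < β) (hL : 0 < L) (N : ℕ) :
    ∃ η > 0, ∀ n ≤ N, ∀ Δ : ℕ → ℝ, (∀ i, 0 ≤ Δ i) → (∀ i < n, Δ (i + 1) ≤ C * Δ i ^ β) →
      L ≤ Δ n → η ≤ Δ 0 := by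
  induction N with
  | zero => exact ⟨L, hL, fun n hn Δ _ _ h => by simpa [Nat.le_zero.1 hn] using h⟩
  | succ N ih =>
    obtain ⟨η, hη, h⟩ := ih
    -- `L` covers `n = 0`; the other entry inverts one Hölder step from the bound for the shifted
    -- sequence.
    refine ⟨min L ((η / C) ^ β⁻¹), by positivity, fun n hn Δ h0 h1 h2 => ?_⟩
    rcases n with _ | n
    · exact (min_le_left _ _).trans h2
    · refine (min_le_right _ _).trans ?_
      have h3 := h n (by omega) (fun i => Δ (i + 1)) (fun i => h0 _)
        (fun i hi => h1 (i + 1) (by omega)) h2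
      have h4 : η / C ≤ Δ 0 ^ β := by
        rw [div_le_iff₀' hC]
        exact h3.trans (h1 0 (by omega))
      calc (η / C) ^ β⁻¹ ≤ (Δ 0 ^ β) ^ β⁻¹ := by gcongr
        _ = Δ 0 := Real.rpow_rpow_inv (h0 0) hβ.ne'

/-! ### Iterates of a Lorenz-like map and their distortion -/

namespace IsLorenzLike

variable {f r : ℝ → ℝ} {β C : ℝ}

theorem inv_le_abs_deriv (h : IsLorenzLike f r β C) {x : ℝ} (hx : x ≠ 0) (hx1 : |x| < 1) :
    C⁻¹ ≤ |deriv f x| := by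
  have hC : 0 < C := zero_lt_one.trans_le h.one_le
  rw [inv_le_iff_one_le_mul₀' hC]
  refine le_trans ?_ (h.lower x hx hx1)
  exact Real.one_le_rpow_of_pos_of_le_one_of_nonpos (abs_pos.2 hx) hx1.le
    (by linarith [h.β_lt_one])

theorem abs_deriv_pos (h : IsLorenzLike f r β C) {x : ℝ} (hx : x ≠ 0) (hx1 : |x| < 1) :
    0 < |deriv f x| :=
  (inv_pos.2 (zero_lt_one.trans_le h.one_le)).trans_le (h.inv_le_abs_deriv hx hx1)

/-- A deliberately crude form of the upper bound, free of real exponents. -/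
theorem abs_deriv_le_div (h : IsLorenzLike f r β C) {x : ℝ} (hx : x ≠ 0) (hx1 : |x| < 1) :
    |deriv f x| ≤ C / |x| := by
  have hC : 0 < C := zero_lt_one.trans_le h.one_le
  refine (h.upper x hx hx1).trans ?_
  rw [div_eq_mul_inv, ← Real.rpow_neg_one]
  exact mul_le_mul_of_nonneg_left (Real.rpow_le_rpow_of_exponent_ge (abs_pos.2 hx) hx1.le
    (by linarith [h.β_pos])) hC.le

theorem abs_iterate_lt_one (h : IsLorenzLike f r β C) {x : ℝ} {t : ℕ} (hx : |x| < 1)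
    (horb : ∀ j < t, f^[j] x ≠ 0) : ∀ j ≤ t, |f^[j] x| < 1 := by
  intro j
  induction j with
  | zero => exact fun _ => hx
  | succ j ih =>
    intro hj
    rw [Function.iterate_succ_apply']
    exact h.abs_lt_one _ (horb j (by omega)) (ih (by omega))

theorem hasDerivAt_iterate (h : IsLorenzLike f r β C) {x : ℝ} {t : ℕ}
    (horb : ∀ j < t, f^[j] x ≠ 0 ∧ |f^[j] x| < 1) : ∀ j ≤ t,
    HasDerivAt f^[j] (∏ i ∈ Finset.range j, deriv f (f^[i] x)) x := by
  intro j
  induction j with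
  | zero => exact fun _ => by simpa using hasDerivAt_id x
  | succ j ih =>
    intro hj
    rw [Finset.prod_range_succ, mul_comm, Function.iterate_succ']
    have h1 := horb j (by omega)
    exact (h.differentiableAt _ h1.1 h1.2).hasDerivAt.comp x (ih (by omega))

/-- Cauchy's mean value theorem for two iterates. -/
theorem exists_ratio (h : IsLorenzLike f r β C) {Q : Set ℝ} (hQ : Q.OrdConnected) {t : ℕ}
    (horb : ∀ x ∈ Q, ∀ j < t, f^[j] x ≠ 0 ∧ |f^[j] x| < 1) {x y : ℝ} (hx : x ∈ Q) (hy : y ∈ Q)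
    {i j : ℕ} (hij : i ≤ j) (hj : j ≤ t) :
    ∃ ξ ∈ Q, |f^[i] x - f^[i] y| * ∏ l ∈ Finset.Ico i j, |deriv f (f^[l] ξ)|
      = |f^[j] x - f^[j] y| := by
  wlog hxy : x ≤ y generalizing x y
  · obtain ⟨ξ, hξ, h1⟩ := this hy hx (le_of_not_ge hxy)
    exact ⟨ξ, hξ, by rw [abs_sub_comm, h1, abs_sub_comm]⟩
  rcases hxy.eq_or_lt with rfl | hlt
  · exact ⟨x, hx, by simp⟩
  have hd : ∀ s ∈ Icc x y, ∀ l ≤ t, HasDerivAt f^[l] (∏ i ∈ Finset.range l, deriv f (f^[i] s)) s :=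
    fun s hs l hl => h.hasDerivAt_iterate (horb s (hQ.out hx hy hs)) l hl
  obtain ⟨ξ, hξ, h1⟩ := exists_ratio_hasDerivAt_eq_ratio_slope f^[j]
    (fun s => ∏ l ∈ Finset.range j, deriv f (f^[l] s)) hlt
    (fun s hs => (hd s hs j hj).continuousAt.continuousWithinAt)
    (fun s hs => hd s (Ioo_subset_Icc_self hs) j hj) f^[i]
    (fun s => ∏ l ∈ Finset.range i, deriv f (f^[l] s))
    (fun s hs => (hd s hs i (hij.trans hj)).continuousAt.continuousWithinAt)
    (fun s hs => hd s (Ioo_subset_Icc_self hs) i (hij.trans hj))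
  have hξQ : ξ ∈ Q := hQ.out hx hy (Ioo_subset_Icc_self hξ)
  refine ⟨ξ, hξQ, ?_⟩
  have hne : ∏ l ∈ Finset.range i, deriv f (f^[l] ξ) ≠ 0 := Finset.prod_ne_zero_iff.2 fun l hl => by
    have h2 := horb ξ hξQ l ((Finset.mem_range.1 hl).trans_le (hij.trans hj))
    exact abs_pos.1 (h.abs_deriv_pos h2.1 h2.2)
  rw [← Finset.prod_range_mul_prod_Ico _ hij, ← mul_assoc, mul_comm _ (∏ l ∈ Finset.range i, _),
    mul_comm _ (∏ l ∈ Finset.range i, _), mul_assoc] at h1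
  rw [← Finset.abs_prod, abs_sub_comm, ← abs_mul, mul_left_cancel₀ hne h1, abs_sub_comm]

/-- The image of `Q` under the iterate is an interval that misses `0`, so it lies on one side of it.
-/
theorem iterate_mul_pos (h : IsLorenzLike f r β C) {Q : Set ℝ} (hQ : Q.OrdConnected) {t : ℕ}
    (horb : ∀ x ∈ Q, ∀ j < t, f^[j] x ≠ 0 ∧ |f^[j] x| < 1) {x y : ℝ} (hx : x ∈ Q) (hy : y ∈ Q)
    {j : ℕ} (hj : j < t) : 0 < f^[j] x * f^[j] y := by
  have hc : ContinuousOn f^[j] Q := fun s hs =>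
    (h.hasDerivAt_iterate (horb s hs) j hj.le).continuousAt.continuousWithinAt
  have himg : (f^[j] '' Q).OrdConnected := (hQ.isPreconnected.image _ hc).ordConnected
  have h0 : (0 : ℝ) ∉ f^[j] '' Q := by
    rintro ⟨s, hs, hs0⟩
    exact (horb s hs j hj).1 hs0
  by_contra hneg
  rcases mul_nonpos_iff.1 (not_lt.1 hneg) with ⟨h1, h2⟩ | ⟨h1, h2⟩
  · exact h0 (himg.out (mem_image_of_mem _ hy) (mem_image_of_mem _ hx) ⟨h2, h1⟩)
  · exact h0 (himg.out (mem_image_of_mem _ hx) (mem_image_of_mem _ hy) ⟨h1, h2⟩)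

/-- Bounded distortion of `f^[n]` from backward contraction and slow recurrence. -/
theorem distortion_iterate (h : IsLorenzLike f r β C) {Q : Set ℝ} (hQ : Q.OrdConnected)
    {t n : ℕ} (horb : ∀ x ∈ Q, ∀ j < t, f^[j] x ≠ 0 ∧ |f^[j] x| < 1) (hnt : n ≤ t)
    (hle : ∀ x ∈ Q, |f^[n] x| ≤ 1) {A l : ℝ} (hl : 0 < l) (hl1 : l < 1)
    (hA : 0 < A) (hexp : ∀ x ∈ Q, ∀ j < n,
      ∏ i ∈ Finset.Ico j n, |deriv f (f^[i] x)|⁻¹ ≤ A * l ^ (4 * (n - j)) ∧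
      l ^ (2 * (n - j)) ≤ A * |f^[j] x|) {x y : ℝ} (hx : x ∈ Q) (hy : y ∈ Q) :
    |∑ i ∈ Finset.range n, Real.log (deriv f (f^[i] x))
      - ∑ i ∈ Finset.range n, Real.log (deriv f (f^[i] y))| ≤ C * (2 * A ^ 2) / (1 - l) := by
  have hC : 0 < C := zero_lt_one.trans_le h.one_le
  have hterm : ∀ j ∈ Finset.range n, |Real.log (deriv f (f^[j] x)) - Real.log (deriv f (f^[j] y))|
      ≤ C * (2 * A ^ 2) * l ^ (n - j) := by
    intro j hj
    have hjn := Finset.mem_range.1 hj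
    have hjt := hjn.trans_le hnt
    have hlm : 0 < l ^ (2 * (n - j)) := pow_pos hl _
    refine (h.log_lipschitz _ _ (h.iterate_mul_pos hQ horb hx hy hjt) (horb x hx j hjt).2
      (horb y hy j hjt).2).trans ?_
    have h1 : |Real.log (f^[j] x) - Real.log (f^[j] y)|
        ≤ |f^[j] x - f^[j] y| / (l ^ (2 * (n - j)) / A) :=
      abs_log_sub_log_le (by positivity)
        ((div_le_iff₀' hA).2 (hexp x hx j hjn).2) ((div_le_iff₀' hA).2 (hexp y hy j hjn).2)
    obtain ⟨ξ, hξ, h2⟩ := h.exists_ratio hQ horb hx hy hjn.le hnt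
    have hprod : 0 < ∏ i ∈ Finset.Ico j n, |deriv f (f^[i] ξ)| := Finset.prod_pos fun i hi => by
      have h3 := horb ξ hξ i ((Finset.mem_Ico.1 hi).2.trans_le hnt)
      exact h.abs_deriv_pos h3.1 h3.2
    -- The contraction is pulled back from time `n`, where the distance is at most 2. Dividing by
    -- the recurrence bound `l ^ (2 * (n - j)) / A` still leaves a summable factor.
    have h3 : |f^[j] x - f^[j] y| ≤ 2 * (A * l ^ (4 * (n - j))) := by
      rw [(eq_mul_inv_iff_mul_eq₀ hprod.ne').2 h2, ← Finset.prod_inv_distrib]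
      refine mul_le_mul ?_ (hexp ξ hξ j hjn).1
        (Finset.prod_nonneg fun i _ => by positivity) zero_le_two
      have := abs_sub (f^[n] x) (f^[n] y)
      linarith [hle x hx, hle y hy]
    rw [mul_assoc]
    refine mul_le_mul_of_nonneg_left (h1.trans ?_) hC.le
    calc _ ≤ 2 * (A * l ^ (4 * (n - j))) / (l ^ (2 * (n - j)) / A) := by gcongr
      _ = 2 * A ^ 2 * l ^ (2 * (n - j)) := by
        rw [show 4 * (n - j) = 2 * (n - j) + 2 * (n - j) by ring, pow_add]
        field_simp
      _ ≤ 2 * A ^ 2 * l ^ (n - j) := by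
        have : l ^ (2 * (n - j)) ≤ l ^ (n - j) :=
          pow_le_pow_of_le_one hl.le hl1.le (by omega)
        gcongr
  rw [← Finset.sum_sub_distrib]
  refine (Finset.abs_sum_le_sum_abs _ _).trans ((Finset.sum_le_sum hterm).trans ?_)
  rw [← Finset.mul_sum, div_eq_mul_one_div]
  exact mul_le_mul_of_nonneg_left (sum_range_pow_sub_le hl hl1 n) (by positivity)

end IsLorenzLike

/-- Outside the `δ`-neighbourhood the truncated distance is 1 while `|y|` is only known to be at
least `δ`; the factor `min δ 1` covers both cases. -/
theorem le_abs_of_le_truncDist {δ s y : ℝ} (hs : s ≤ 1) (hs0 : 0 ≤ s) (hδ : 0 < δ)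
    (h : s ≤ truncDist δ y) : min δ 1 * s ≤ |y| := by
  unfold truncDist at h
  split_ifs at h with hy
  · exact (mul_le_of_le_one_left hs0 (min_le_right _ _)).trans h
  · exact (mul_le_of_le_one_right (by positivity) hs).trans ((min_le_left _ _).trans (not_lt.1 hy))

/-! ### Induced maps: contraction, the last steps, and the induced roof -/

namespace HyperbolicInducing

variable {f r : ℝ → ℝ} {β C : ℝ}

theorem orbit (S : HyperbolicInducing f) (h : IsLorenzLike f r β C) {Q : Set ℝ} (hQ : Q ∈ S.part)
    {x : ℝ} (hx : x ∈ Q) : ∀ j < S.τ x, f^[j] x ≠ 0 ∧ |f^[j] x| < 1 := by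
  have h1 := S.part_subset Q hQ hx
  have h2 : |x| < 1 := abs_lt.2
    ⟨S.left_mem.1.trans_lt h1.1, h1.2.trans_le S.right_mem.2⟩
  intro j hj
  exact ⟨S.orbit_ne_zero Q hQ x hx j hj,
    h.abs_iterate_lt_one h2 (S.orbit_ne_zero Q hQ x hx) j hj.le⟩

/-- Hyperbolic times give backward contraction and slow recurrence up to the time `τ - N`. -/
theorem exists_contraction (S : HyperbolicInducing f) (h : IsLorenzLike f r β C) :
    ∃ (N : ℕ) (A l : ℝ), 0 < A ∧ 0 < l ∧ l < 1 ∧ ∀ Q ∈ S.part, ∀ x ∈ Q, ∀ j < S.τ x - N,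
      ∏ i ∈ Finset.Ico j (S.τ x - N), |deriv f (f^[i] x)|⁻¹ ≤ A * l ^ (4 * (S.τ x - N - j)) ∧
      l ^ (2 * (S.τ x - N - j)) ≤ A * |f^[j] x| := by
  obtain ⟨σ, δ, c, N, hσ, hσ1, hδ, hc, hc2, hyp⟩ := S.hyperbolic_times
  have hC : 0 < C := zero_lt_one.trans_le h.one_le
  set l : ℝ := σ ^ (1 / 4 : ℝ) with hldef
  have hl : 0 < l := Real.rpow_pos_of_pos hσ _
  have hl1 : l < 1 := Real.rpow_lt_one hσ.le hσ1 (by norm_num)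
  have hlσ : ∀ k : ℕ, σ ^ k = l ^ (4 * k) := fun k => by
    rw [pow_mul, hldef, ← Real.rpow_natCast (σ ^ (1 / 4 : ℝ)) 4, ← Real.rpow_mul hσ.le]
    norm_num
  -- Here `c ≤ 1 / 2` is used, since `l ^ (2 * k) = σ ^ (k / 2)`.
  have hlc : ∀ k : ℕ, l ^ (2 * k) ≤ σ ^ (c * (k : ℝ)) := fun k => by
    have h1 : l ^ (2 * k) = σ ^ ((1 / 2 : ℝ) * k) := by
      rw [hldef, ← Real.rpow_natCast, ← Real.rpow_mul hσ.le]
      congr 1; push_cast; ring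
    rw [h1]
    exact Real.rpow_le_rpow_of_exponent_ge hσ hσ1.le (by gcongr)
  set d := min δ 1 with hd
  have hd0 : 0 < d := by positivity
  set B := max 1 (C / (d * l ^ (2 * N))) with hB
  have hB1 : 1 ≤ B := le_max_left _ _
  refine ⟨N, max (B ^ N) (1 / (d * l ^ (2 * N))), l, by positivity, hl, hl1,
    fun Q hQ x hx j hj => ?_⟩
  obtain ⟨n, k, -, hkN, hτ, hn⟩ := hyp Q hQ x hx
  have horb := S.orbit h hQ hx
  have hlow : ∀ i < n, d * l ^ (2 * (n - i)) ≤ |f^[i] x| := fun i hi => by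
    have h1 := (hn (n - i) (by omega) (by omega)).2
    rw [show n - (n - i) = i by omega] at h1
    exact le_abs_of_le_truncDist (pow_le_one₀ hl.le hl1.le) (by positivity) hδ
      ((hlc _).trans h1)
  -- The hyperbolic time `n` may vary with the point, whereas `τ - N` is constant on a partition
  -- element and at most `n`. The at most `N` factors between them are bounded, since the recurrence
  -- condition keeps the orbit away from `0` there.
  set n₀ := S.τ x - N with hn₀
  have hn₀n : n₀ ≤ n := by omega
  have hnN : n - n₀ ≤ N := by omega
  constructor
  · have h1 := (hn (n - j) (by omega) (by omega)).1
    rw [show n - (n - j) = j by omega, ← Finset.prod_Ico_consecutive _ hj.le hn₀n] at h1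
    have hpos : ∀ i < n, 0 < |deriv f (f^[i] x)| := fun i hi =>
      h.abs_deriv_pos (horb i (by omega)).1 (horb i (by omega)).2
    have h2 : ∏ i ∈ Finset.Ico n₀ n, |deriv f (f^[i] x)| ≤ B ^ N := by
      refine prod_Ico_le_pow hB1 hnN fun i hi => ⟨abs_nonneg _, ?_⟩
      · have hi' := Finset.mem_Ico.1 hi
        refine (h.abs_deriv_le_div (horb i (by omega)).1 (horb i (by omega)).2).trans
          (le_trans ?_ (le_max_right _ _))
        refine div_le_div_of_nonneg_left hC.le (by positivity) (le_trans ?_ (hlow i hi'.2))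
        exact mul_le_mul_of_nonneg_left
          (pow_le_pow_of_le_one hl.le hl1.le (by omega)) hd0.le
    have hp : 0 < ∏ i ∈ Finset.Ico n₀ n, |deriv f (f^[i] x)| :=
      Finset.prod_pos fun i hi => hpos i (Finset.mem_Ico.1 hi).2
    rw [Finset.prod_inv_distrib (s := Finset.Ico n₀ n), ← div_eq_mul_inv, div_le_iff₀ hp,
      hlσ] at h1
    refine h1.trans ?_
    rw [mul_comm]
    exact mul_le_mul (h2.trans (le_max_left _ _))
      (pow_le_pow_of_le_one hl.le hl1.le (by omega)) (by positivity) (by positivity)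
  · have h1 := hlow j (by omega)
    have h2 : l ^ (2 * N) * l ^ (2 * (n₀ - j)) ≤ l ^ (2 * (n - j)) := by
      rw [← pow_add]
      exact pow_le_pow_of_le_one hl.le hl1.le (by omega)
    calc l ^ (2 * (n₀ - j)) = 1 / (d * l ^ (2 * N)) * (d * (l ^ (2 * N) * l ^ (2 * (n₀ - j)))) := by
          field_simp
      _ ≤ 1 / (d * l ^ (2 * N)) * (d * l ^ (2 * (n - j))) := by gcongr
      _ ≤ _ := by
          refine mul_le_mul (le_max_right _ _) h1 (by positivity) (by positivity)

theorem hasDerivAt_induced (S : HyperbolicInducing f) (h : IsLorenzLike f r β C) {Q : Set ℝ}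
    (hQ : Q ∈ S.part) {x : ℝ} (hx : x ∈ Q) :
    HasDerivAt (fun x => f^[S.τ x] x) (∏ i ∈ Finset.range (S.τ x), deriv f (f^[i] x)) x := by
  refine (h.hasDerivAt_iterate (S.orbit h hQ hx) _ le_rfl).congr_of_eventuallyEq ?_
  obtain ⟨p, q, -, rfl⟩ := S.part_interval Q hQ
  filter_upwards [isOpen_Ioo.mem_nhds hx] with y hy
  rw [S.τ_const _ hQ y hy x hx]

/-- During the last `N` steps before the inducing time orbits stay away from the singularity. -/
theorem exists_lower_bound_tail (S : HyperbolicInducing f) (h : IsLorenzLike f r β C) {N : ℕ}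
    {A l : ℝ} (hA : 0 < A) (hl : 0 < l) (hl1 : l < 1)
    (hexp : ∀ Q ∈ S.part, ∀ x ∈ Q, ∀ j < S.τ x - N,
      ∏ i ∈ Finset.Ico j (S.τ x - N), |deriv f (f^[i] x)|⁻¹ ≤ A * l ^ (4 * (S.τ x - N - j)) ∧
      l ^ (2 * (S.τ x - N - j)) ≤ A * |f^[j] x|) :
    ∃ η > 0, ∀ Q ∈ S.part, ∀ x ∈ Q, ∀ k, S.τ x - N ≤ k → k < S.τ x → η ≤ |f^[k] x| := by
  have hC : 0 < C := zero_lt_one.trans_le h.one_le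
  have hlogC : 0 ≤ Real.log C := Real.log_nonneg h.one_le
  obtain ⟨K, α, hα, hdist⟩ := S.distortion
  have hleft := S.left_mem.2
  have hright := S.right_mem.1
  set L := (S.right - S.left) / 2 with hL
  have hL0 : 0 < L := by rw [hL]; linarith
  obtain ⟨η, hη, hη'⟩ := exists_lower_bound_of_hoelder hC h.β_pos hL0 N
  set K₁ := C * (2 * A ^ 2) / (1 - l) with hK₁
  set K₂ := |K| * 2 ^ α with hK₂
  set K₃ := K₁ + K₂ + Real.log (L / η) + (N + 1) * Real.log C with hK₃
  refine ⟨Real.exp (-(K₃ / (1 - β))), Real.exp_pos _, fun Q hQ x hx k hk hkt => ?_⟩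
  set t := S.τ x with ht
  set n := t - N with hn
  have hτ : ∀ y ∈ Q, S.τ y = t := fun y hy => S.τ_const Q hQ y hy x hx
  have hQc : Q.OrdConnected := by
    obtain ⟨p, q, -, rfl⟩ := S.part_interval Q hQ
    exact ordConnected_Ioo
  have horb : ∀ y ∈ Q, ∀ j < t, f^[j] y ≠ 0 ∧ |f^[j] y| < 1 := fun y hy => by
    rw [← hτ y hy]
    exact S.orbit h hQ hy
  have hlast : ∀ y ∈ Q, f^[t] y ∈ Ioo S.left S.right := fun y hy => by
    have := (S.full_branch Q hQ).mapsTo hy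
    simp only [hτ y hy] at this
    exact this
  have hpos : ∀ y ∈ Q, ∀ i < t, 0 < |deriv f (f^[i] y)| := fun y hy i hi =>
    h.abs_deriv_pos (horb y hy i hi).1 (horb y hy i hi).2
  have hle : ∀ y ∈ Q, |f^[n] y| ≤ 1 := fun y hy => by
    refine (h.abs_iterate_lt_one (horb y hy 0 (by omega)).2
      (fun j hj => (horb y hy j hj).1) n (by omega)).le
  have hdn : ∀ y ∈ Q, ∀ z ∈ Q, |∑ i ∈ Finset.range n, Real.log (deriv f (f^[i] y))
      - ∑ i ∈ Finset.range n, Real.log (deriv f (f^[i] z))| ≤ K₁ := fun y hy z hz =>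
    h.distortion_iterate hQc horb (Nat.sub_le _ _) hle hl hl1 hA (fun y hy => by
      have := hexp Q hQ y hy
      rwa [hτ y hy] at this) hy hz
  have hlogprod : ∀ y ∈ Q, Real.log |deriv (fun x => f^[S.τ x] x) y|
      = ∑ i ∈ Finset.range t, Real.log (deriv f (f^[i] y)) := fun y hy => by
    rw [(S.hasDerivAt_induced h hQ hy).deriv, hτ y hy, Real.log_abs, Real.log_prod]
    exact fun i hi => abs_pos.1 (hpos y hy i (Finset.mem_range.1 hi))
  have hne : ∀ y ∈ Q, |deriv (fun x => f^[S.τ x] x) y| ≠ 0 := fun y hy => by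
    obtain ⟨ρ, hρ, h1⟩ := S.expanding
    exact (zero_lt_one.trans (hρ.trans_le (h1 Q hQ y hy))).ne'
  have hdt : ∀ y ∈ Q, ∀ z ∈ Q, |∑ i ∈ Finset.range t, Real.log (deriv f (f^[i] y))
      - ∑ i ∈ Finset.range t, Real.log (deriv f (f^[i] z))| ≤ K₂ := fun y hy z hz => by
    have h1 := hdist Q hQ y hy z hz
    rw [Real.log_div (hne y hy) (hne z hz), hlogprod y hy, hlogprod z hz] at h1
    refine h1.trans ?_
    rw [hτ y hy, hτ z hz]
    have h2 : |f^[t] y - f^[t] z| ≤ 2 := by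
      have h3 := hlast y hy
      have h4 := hlast z hz
      have := S.left_mem.1
      have := S.right_mem.2
      exact abs_le.2 ⟨by linarith [h3.1, h4.2], by linarith [h3.2, h4.1]⟩
    calc _ ≤ |K| * |f^[t] y - f^[t] z| ^ α := by gcongr; exact le_abs_self K
      _ ≤ |K| * 2 ^ α := by gcongr
  -- Full branches provide two points of `Q` whose images at time `t` are the half-endpoints, at
  -- distance `L`.
  obtain ⟨u, hu, hu'⟩ := (S.full_branch Q hQ).surjOn
    (show S.left / 2 ∈ Ioo S.left S.right from ⟨by linarith, by linarith⟩)
  obtain ⟨v, hv, hv'⟩ := (S.full_branch Q hQ).surjOn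
    (show S.right / 2 ∈ Ioo S.left S.right from ⟨by linarith, by linarith⟩)
  simp only [hτ u hu, hτ v hv] at hu' hv'
  have huv : |f^[t] u - f^[t] v| = L := by
    rw [hu', hv', abs_sub_comm, abs_of_pos (by linarith), hL]; ring
  have hΔ : η ≤ |f^[n] u - f^[n] v| := by
    refine hη' (t - n) (by omega) (fun i => |f^[n + i] u - f^[n + i] v|) (fun i => abs_nonneg _)
      (fun i hi => ?_) ?_
    · simp only [← add_assoc, Function.iterate_succ_apply']
      exact h.hoelder _ _ (h.iterate_mul_pos hQc horb hu hv (by omega))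
        (horb u hu _ (by omega)).2 (horb v hv _ (by omega)).2
    · rw [show n + (t - n) = t by omega, huv]
  -- The final block stretches a distance at least `η` to exactly `L`, so at some `ξ` its derivative
  -- is at most `L / η`. Distortion carries this to every point of `Q`.
  obtain ⟨ξ, hξ, hratio⟩ := h.exists_ratio hQc horb hu hv (show n ≤ t by omega) le_rfl
  have hIco : ∀ y, ∑ i ∈ Finset.Ico n t, Real.log (deriv f (f^[i] y))
      = ∑ i ∈ Finset.range t, Real.log (deriv f (f^[i] y))
        - ∑ i ∈ Finset.range n, Real.log (deriv f (f^[i] y)) := fun y =>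
    Finset.sum_Ico_eq_sub _ (by omega)
  have hξlog : ∑ i ∈ Finset.Ico n t, Real.log (deriv f (f^[i] ξ)) ≤ Real.log (L / η) := by
    have h1 : ∑ i ∈ Finset.Ico n t, Real.log (deriv f (f^[i] ξ))
        = Real.log (∏ i ∈ Finset.Ico n t, |deriv f (f^[i] ξ)|) := by
      rw [Real.log_prod fun i hi => (hpos ξ hξ i (Finset.mem_Ico.1 hi).2).ne']
      simp only [Real.log_abs]
    rw [h1]
    refine Real.log_le_log (Finset.prod_pos fun i hi => hpos ξ hξ i (Finset.mem_Ico.1 hi).2) ?_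
    rw [le_div_iff₀ hη, ← huv, ← hratio, mul_comm]
    exact mul_le_mul_of_nonneg_right hΔ (Finset.prod_nonneg fun i _ => abs_nonneg _)
  have hxlog : ∑ i ∈ Finset.Ico n t, Real.log (deriv f (f^[i] x))
      ≤ K₁ + K₂ + Real.log (L / η) := by
    have h1 := (abs_le.1 (hdt x hx ξ hξ)).2
    have h2 := (abs_le.1 (hdn x hx ξ hξ)).1
    have h3 := hIco x
    have h4 := hIco ξ
    linarith
  have hlogd : ∀ i < t, -Real.log C ≤ Real.log (deriv f (f^[i] x)) := fun i hi => by
    rw [← Real.log_inv, ← Real.log_abs (deriv f _)]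
    exact Real.log_le_log (by positivity) (h.inv_le_abs_deriv (horb x hx i hi).1 (horb x hx i hi).2)
  have hk1 : Real.log (deriv f (f^[k] x)) ≤ K₁ + K₂ + Real.log (L / η) + N * Real.log C := by
    -- Adding `log C` makes every summand nonnegative, so a single one is bounded by the whole sum.
    have h1 : Real.log (deriv f (f^[k] x)) + Real.log C
        ≤ ∑ i ∈ Finset.Ico n t, (Real.log (deriv f (f^[i] x)) + Real.log C) :=
      Finset.single_le_sum (f := fun i => Real.log (deriv f (f^[i] x)) + Real.log C)
        (fun i hi => by linarith [hlogd i (Finset.mem_Ico.1 hi).2]) (Finset.mem_Ico.2 ⟨hk, hkt⟩)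
    rw [Finset.sum_add_distrib, Finset.sum_const, Nat.card_Ico, nsmul_eq_mul] at h1
    have h2 : ((t - n : ℕ) : ℝ) ≤ N := by exact_mod_cast (by omega : t - n ≤ N)
    nlinarith
  obtain ⟨hk0, hklt⟩ := horb x hx k hkt
  have hk2 : (β - 1) * Real.log |f^[k] x| ≤ Real.log C + Real.log (deriv f (f^[k] x)) := by
    have h1 := h.lower _ hk0 hklt
    have h2 := Real.log_le_log (Real.rpow_pos_of_pos (abs_pos.2 hk0) _) h1
    rwa [Real.log_rpow (abs_pos.2 hk0), Real.log_mul hC.ne' (hpos x hx k hkt).ne',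
      Real.log_abs (deriv f _)] at h2
  rw [← Real.le_log_iff_exp_le (abs_pos.2 hk0), neg_le, ← sub_nonneg]
  have hβ : 0 < 1 - β := by linarith [h.β_lt_one]
  rw [sub_nonneg, le_div_iff₀ hβ, hK₃]
  linarith

theorem hasDerivAt_roof (S : HyperbolicInducing f) (h : IsLorenzLike f r β C) {Q : Set ℝ}
    (hQ : Q ∈ S.part) {x : ℝ} (hx : x ∈ Q) :
    HasDerivAt (S.roof r) (∑ k ∈ Finset.range (S.τ x),
      deriv r (f^[k] x) * ∏ i ∈ Finset.range k, deriv f (f^[i] x)) x := by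
  have horb := S.orbit h hQ hx
  have h1 : HasDerivAt (fun y => ∑ k ∈ Finset.range (S.τ x), r (f^[k] y))
      (∑ k ∈ Finset.range (S.τ x),
        deriv r (f^[k] x) * ∏ i ∈ Finset.range k, deriv f (f^[i] x)) x := by
    refine HasDerivAt.fun_sum fun k hk => ?_
    have hk' := Finset.mem_range.1 hk
    exact (h.differentiableAt_roof _ (horb k hk').1 (horb k hk').2).hasDerivAt.comp x
      (h.hasDerivAt_iterate horb k hk'.le)
  refine h1.congr_of_eventuallyEq ?_
  obtain ⟨p, q, -, rfl⟩ := S.part_interval Q hQ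
  filter_upwards [isOpen_Ioo.mem_nhds hx] with y hy
  rw [roof, S.τ_const _ hQ y hy x hx]

/-- An inverse branch is not assumed continuous; injectivity of the induced map on `Q` forces it to
agree with the local inverse. -/
theorem hasDerivAt_of_rightInverse (S : HyperbolicInducing f) (h : IsLorenzLike f r β C)
    {Q : Set ℝ} {g : ℝ → ℝ} (hg : MapsTo g S.X Q) (hQ : Q ∈ S.part) (hgF : ∀ x ∈ S.X, S.F (g x) = x)
    {x : ℝ} (hx : x ∈ S.X) :
    HasDerivAt g (∏ i ∈ Finset.range (S.τ (g x)), deriv f (f^[i] (g x)))⁻¹ x := by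
  have hgx := hg hx
  have hQo : Q ∈ 𝓝 (g x) := by
    obtain ⟨p, q, -, rfl⟩ := S.part_interval Q hQ
    exact isOpen_Ioo.mem_nhds hgx
  have h1 := S.hasDerivAt_induced h hQ hgx
  have h2 := ((S.smooth Q hQ).contDiffAt hQo).hasStrictDerivAt (by norm_num)
  rw [h1.deriv] at h2
  refine h2.hasDerivAt_of_rightInverse ?_ hQo (S.full_branch Q hQ).injOn (hgF x hx) ?_
  · refine Finset.prod_ne_zero_iff.2 fun i hi => ?_
    have h3 := S.orbit h hQ hgx i (Finset.mem_range.1 hi)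
    exact abs_pos.1 (h.abs_deriv_pos h3.1 h3.2)
  · filter_upwards [isOpen_Ioo.mem_nhds hx] with y hy
    exact ⟨hg hy, hgF y hy⟩

/-- Uniform bound for the derivative of the induced roof function along inverse branches. -/
theorem exists_bound_deriv_roof_comp (S : HyperbolicInducing f) (h : IsLorenzLike f r β C) :
    ∃ K : ℝ, ∀ g : ℝ → ℝ, S.IsInverseBranch g → ∀ x ∈ S.X,
      DifferentiableAt ℝ (S.roof r ∘ g) x ∧ |deriv (S.roof r ∘ g) x| ≤ K := by
  obtain ⟨N, A, l, hA, hl, hl1, hexp⟩ := S.exists_contraction h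
  obtain ⟨η, hη, htail⟩ := S.exists_lower_bound_tail h hA hl hl1 hexp
  have hC : 0 < C := zero_lt_one.trans_le h.one_le
  set K₁ := C * A ^ (3 / 2 : ℝ) * A * C ^ N with hK₁
  set K₂ := C * η ^ (-(3 / 2) : ℝ) * C ^ N with hK₂
  have hK₂0 : 0 < K₂ := by positivity
  refine ⟨K₁ * (1 / (1 - l)) + N * K₂, ?_⟩
  rintro g ⟨Q, hQ, hg, hgF⟩ x hx
  set y := g x with hy
  have hyQ : y ∈ Q := hg hx
  set t := S.τ y with ht
  have horb := S.orbit h hQ hyQ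
  have hd := (S.hasDerivAt_roof h hQ hyQ).comp x (S.hasDerivAt_of_rightInverse h hg hQ hgF hx)
  refine ⟨hd.differentiableAt, ?_⟩
  rw [hd.deriv, ← ht, Finset.sum_mul]
  have hpos : ∀ i < t, 0 < |deriv f (f^[i] y)| := fun i hi =>
    h.abs_deriv_pos (horb i hi).1 (horb i hi).2
  have hinv : ∀ m ≤ t, t - N ≤ m → ∏ i ∈ Finset.Ico m t, |deriv f (f^[i] y)|⁻¹ ≤ C ^ N := by
    intro m hm hNm
    refine prod_Ico_le_pow h.one_le (by omega) fun i hi => ⟨by positivity, ?_⟩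
    have hi' := (Finset.mem_Ico.1 hi).2
    exact inv_le_of_inv_le₀ hC (h.inv_le_abs_deriv (horb i hi').1 (horb i hi').2)
  have hterm : ∀ k < t, |deriv r (f^[k] y) * (∏ i ∈ Finset.range k, deriv f (f^[i] y))
      * (∏ i ∈ Finset.range t, deriv f (f^[i] y))⁻¹|
      = |deriv r (f^[k] y)| * ∏ i ∈ Finset.Ico k t, |deriv f (f^[i] y)|⁻¹ := fun k hk => by
    have hne : ∏ i ∈ Finset.range k, deriv f (f^[i] y) ≠ 0 :=
      Finset.prod_ne_zero_iff.2 fun i hi =>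
        abs_pos.1 (hpos i ((Finset.mem_range.1 hi).trans hk))
    rw [← Finset.prod_range_mul_prod_Ico _ hk.le, mul_inv, mul_assoc, mul_inv_cancel_left₀ hne,
      abs_mul, abs_inv, Finset.abs_prod, Finset.prod_inv_distrib]
  have hnonneg : ∀ m n, 0 ≤ ∏ i ∈ Finset.Ico m n, |deriv f (f^[i] y)|⁻¹ := fun m n =>
    Finset.prod_nonneg fun i _ => by positivity
  have hfirst : ∀ k ∈ Finset.range (t - N),
      |deriv r (f^[k] y) * (∏ i ∈ Finset.range k, deriv f (f^[i] y))
      * (∏ i ∈ Finset.range t, deriv f (f^[i] y))⁻¹| ≤ K₁ * l ^ (t - N - k) := by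
    intro k hk
    have hk' := Finset.mem_range.1 hk
    have hkt : k < t := by omega
    obtain ⟨e1, e2⟩ := hexp Q hQ y hyQ k hk'
    rw [← ht] at e1 e2
    have hlm : 0 < l ^ (t - N - k) := pow_pos hl _
    rw [hterm k hkt, ← Finset.prod_Ico_consecutive _ hk'.le (Nat.sub_le t N)]
    -- The recurrence rate `l²` to the power `-3/2` costs `l⁻³` per step, against a gain of `l⁴`;
    -- one factor `l` survives.
    have h1 : |f^[k] y| ^ (-(3 / 2) : ℝ) ≤ A ^ (3 / 2 : ℝ) * (l ^ (3 * (t - N - k)))⁻¹ := by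
      have h2 : l ^ (2 * (t - N - k)) / A ≤ |f^[k] y| := (div_le_iff₀' hA).2 e2
      refine (Real.rpow_le_rpow_of_nonpos (by positivity) h2 (by norm_num)).trans_eq ?_
      rw [Real.div_rpow (by positivity) hA.le, Real.rpow_neg hA.le, div_inv_eq_mul, mul_comm,
        Real.rpow_neg (by positivity), ← Real.rpow_natCast, ← Real.rpow_mul hl.le,
        ← Real.rpow_natCast l (3 * _)]
      congr 3
      push_cast
      ring
    calc _ ≤ (C * (A ^ (3 / 2 : ℝ) * (l ^ (3 * (t - N - k)))⁻¹))
          * (A * l ^ (4 * (t - N - k)) * C ^ N) := by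
          refine mul_le_mul ((h.abs_deriv_roof_le _ (horb k hkt).1 (horb k hkt).2).trans
            (mul_le_mul_of_nonneg_left h1 hC.le)) ?_ (mul_nonneg (hnonneg _ _) (hnonneg _ _))
            (by positivity)
          exact mul_le_mul e1 (hinv _ (Nat.sub_le t N) le_rfl) (hnonneg _ _) (by positivity)
      _ = _ := by
          rw [show 4 * (t - N - k) = 3 * (t - N - k) + (t - N - k) by ring, pow_add, hK₁]
          field_simp
  have hsecond : ∀ k ∈ Finset.Ico (t - N) t,
      |deriv r (f^[k] y) * (∏ i ∈ Finset.range k, deriv f (f^[i] y))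
      * (∏ i ∈ Finset.range t, deriv f (f^[i] y))⁻¹| ≤ K₂ := by
    intro k hk
    obtain ⟨hk1, hkt⟩ := Finset.mem_Ico.1 hk
    rw [hterm k hkt]
    have h1 : |f^[k] y| ^ (-(3 / 2) : ℝ) ≤ η ^ (-(3 / 2) : ℝ) :=
      Real.rpow_le_rpow_of_nonpos hη (htail Q hQ y hyQ k hk1 hkt) (by norm_num)
    exact mul_le_mul ((h.abs_deriv_roof_le _ (horb k hkt).1 (horb k hkt).2).trans
      (mul_le_mul_of_nonneg_left h1 hC.le)) (hinv k hkt.le hk1) (hnonneg _ _) (by positivity)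
  refine (Finset.abs_sum_le_sum_abs _ _).trans ?_
  rw [← Finset.sum_range_add_sum_Ico _ (Nat.sub_le t N)]
  refine add_le_add ((Finset.sum_le_sum hfirst).trans ?_)
    ((Finset.sum_le_card_nsmul _ _ K₂ hsecond).trans ?_)
  · rw [← Finset.mul_sum]
    exact mul_le_mul_of_nonneg_left (sum_range_pow_sub_le hl hl1 _) (by positivity)
  · rw [Nat.card_Ico, nsmul_eq_mul]
    refine mul_le_mul_of_nonneg_right ?_ hK₂0.le
    exact_mod_cast (by omega : t - (t - N) ≤ N)

end HyperbolicInducing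

/-! ### The one-dimensional map and the roof function of the model -/

theorem ContDiffOn.exists_abs_deriv_le {θ : ℝ → ℝ} (h : ContDiffOn ℝ 1 θ (Icc 0 1)) :
    ∃ K, 0 ≤ K ∧ ∀ w ∈ Ioo (0 : ℝ) 1, HasDerivAt θ (deriv θ w) w ∧ |deriv θ w| ≤ K := by
  have hc := h.continuousOn_derivWithin (uniqueDiffOn_Icc zero_lt_one) le_rfl
  obtain ⟨K, hK⟩ := isCompact_Icc.exists_bound_of_continuousOn hc
  refine ⟨K, (norm_nonneg _).trans (hK 0 (by simp)), fun w hw => ?_⟩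
  have hn := Icc_mem_nhds hw.1 hw.2
  refine ⟨((h.contDiffAt hn).differentiableAt one_ne_zero).hasDerivAt, ?_⟩
  rw [← derivWithin_of_mem_nhds hn]
  exact hK w (Ioo_subset_Icc_self hw)

namespace NeutralModel

variable (M : NeutralModel)

/-- The derivative of the Dulac map. -/
noncomputable def dulac' (x : ℝ) : ℝ := M.dulac x / x * M.κ (-(2 * Real.log x))

theorem dulac_mem_Ioo {x : ℝ} (hx : x ∈ Ioo (0 : ℝ) 1) : M.dulac x ∈ Ioo (0 : ℝ) 1 := by
  rw [(M.dulac_eq_and_dulacTime_eq hx.1 hx.2).1]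
  refine ⟨Real.exp_pos _, Real.exp_lt_one_iff.2 ?_⟩
  have h1 := M.Ψ_lt_zero (q := -(2 * Real.log x)) (by have := Real.log_neg hx.1 hx.2; linarith)
  linarith

theorem hasDerivAt_neg_two_log {x : ℝ} (hx : 0 < x) :
    HasDerivAt (fun x => -(2 * Real.log x)) (-(2 * x⁻¹)) x :=
  ((Real.hasDerivAt_log hx.ne').const_mul 2).neg

theorem hasDerivAt_dulac {x : ℝ} (hx : x ∈ Ioo (0 : ℝ) 1) :
    HasDerivAt M.dulac (M.dulac' x) x := by
  have h1 := (((M.hasDerivAt_Ψ (-(2 * Real.log x))).comp x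
    (hasDerivAt_neg_two_log hx.1)).div_const 2).exp
  refine (h1.congr_of_eventuallyEq ?_).congr_deriv ?_
  · filter_upwards [isOpen_Ioo.mem_nhds hx] with y hy
    exact (M.dulac_eq_and_dulacTime_eq hy.1 hy.2).1
  · rw [dulac', (M.dulac_eq_and_dulacTime_eq hx.1 hx.2).1]
    simp only [Function.comp]
    ring

theorem dulac'_pos {x : ℝ} (hx : x ∈ Ioo (0 : ℝ) 1) : 0 < M.dulac' x := by
  obtain ⟨m, hm, K, hK⟩ := M.κ_bounds
  exact mul_pos (div_pos (M.dulac_mem_Ioo hx).1 hx.1) (hm.trans_le (hK _).1)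

/-- With `q = -2 log x` the bounded error in `Ψ q = -β q + O(1)` turns into a multiplicative
constant, and `κ` lies between positive constants. -/
theorem dulac'_bounds : ∃ C > 0, ∀ x ∈ Ioo (0 : ℝ) 1,
    x ^ (M.β - 1) ≤ C * M.dulac' x ∧ M.dulac' x ≤ C * x ^ (M.β - 1) := by
  obtain ⟨K, hK⟩ := M.Ψ_asymptotics
  obtain ⟨m, hm, k, hk⟩ := M.κ_bounds
  have hk0 : 0 < k := hm.trans_le ((hk 0).1.trans (hk 0).2)
  refine ⟨max (Real.exp (K / 2) / m) (Real.exp (K / 2) * k), by positivity, fun x hx => ?_⟩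
  have hx0 := hx.1
  have hlog := Real.log_neg hx.1 hx.2
  have h1 := abs_le.1 (hK (-(2 * Real.log x)) (by linarith))
  have hD := (M.dulac_eq_and_dulacTime_eq hx.1 hx.2).1
  have hD0 := (M.dulac_mem_Ioo hx).1
  have hxβ : x ^ M.β = Real.exp (Real.log x * M.β) := Real.rpow_def_of_pos hx.1 _
  have e1 : x ^ M.β ≤ Real.exp (K / 2) * M.dulac x := by
    rw [hD, hxβ, ← Real.exp_add, Real.exp_le_exp]
    linarith
  have e2 : M.dulac x ≤ Real.exp (K / 2) * x ^ M.β := by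
    rw [hD, hxβ, ← Real.exp_add, Real.exp_le_exp]
    linarith
  obtain ⟨k1, k2⟩ := hk (-(2 * Real.log x))
  rw [Real.rpow_sub_one hx.1.ne', dulac']
  constructor
  · calc x ^ M.β / x ≤ Real.exp (K / 2) * M.dulac x / x := by gcongr
      _ = Real.exp (K / 2) / m * (M.dulac x / x * m) := by field_simp
      _ ≤ _ := by gcongr; exact le_max_left _ _
  · have hκ := hm.le.trans k1
    calc _ ≤ Real.exp (K / 2) * x ^ M.β / x * k := by gcongr
      _ = Real.exp (K / 2) * k * (x ^ M.β / x) := by ring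
      _ ≤ _ := by
        have : 0 ≤ x ^ M.β / x := by positivity
        gcongr; exact le_max_right _ _

theorem log_dulac'_lipschitz : ∃ C, 0 ≤ C ∧ ∀ x ∈ Ioo (0 : ℝ) 1, ∀ y ∈ Ioo (0 : ℝ) 1,
    |Real.log (M.dulac' x) - Real.log (M.dulac' y)| ≤ C * |Real.log x - Real.log y| := by
  obtain ⟨C, hC, h⟩ := M.lipschitz_log_κ
  obtain ⟨m, hm, k, hk⟩ := M.κ_bounds
  have hlog : ∀ x ∈ Ioo (0 : ℝ) 1, Real.log (M.dulac' x)
      = M.Ψ (-(2 * Real.log x)) / 2 - Real.log x + Real.log (M.κ (-(2 * Real.log x))) := by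
    intro x hx
    rw [dulac', Real.log_mul (div_pos (M.dulac_mem_Ioo hx).1 hx.1).ne'
      (hm.trans_le (hk _).1).ne', Real.log_div (M.dulac_mem_Ioo hx).1.ne' hx.1.ne',
      (M.dulac_eq_and_dulacTime_eq hx.1 hx.2).1, Real.log_exp]
  refine ⟨3 * C + 1, by positivity, fun x hx y hy => ?_⟩
  obtain ⟨h1, h2⟩ := h (-(2 * Real.log x)) (-(2 * Real.log y))
  have h3 : |-(2 * Real.log x) - -(2 * Real.log y)| = 2 * |Real.log x - Real.log y| := by
    rw [show -(2 * Real.log x) - -(2 * Real.log y) = -2 * (Real.log x - Real.log y) by ring,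
      abs_mul]
    norm_num
  rw [h3] at h1 h2
  have h4 := abs_le.1 h1
  have h5 := abs_le.1 h2
  have h6 := abs_le.1 (le_refl |Real.log x - Real.log y|)
  rw [hlog x hx, hlog y hy, abs_le]
  constructor <;> linarith

/-- Both `D` and `(C/β) x^β - D` are nondecreasing, so increments of `D` are dominated by those of
`(C/β) x^β`, and `x^β` is subadditive. -/
theorem dulac_hoelder : ∃ C, 0 ≤ C ∧ ∀ x ∈ Ioo (0 : ℝ) 1, ∀ y ∈ Ioo (0 : ℝ) 1,
    |M.dulac x - M.dulac y| ≤ C * |x - y| ^ M.β := by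
  obtain ⟨C, hC, h⟩ := M.dulac'_bounds
  have hβ := M.β_pos
  refine ⟨C / M.β, by positivity, ?_⟩
  have hmono : MonotoneOn M.dulac (Ioo 0 1) :=
    monotoneOn_of_deriv_nonneg (convex_Ioo _ _)
      (fun x hx => (M.hasDerivAt_dulac hx).continuousAt.continuousWithinAt)
      (fun x hx => (M.hasDerivAt_dulac
        (interior_subset hx)).differentiableAt.differentiableWithinAt)
      fun x hx => by
        rw [(M.hasDerivAt_dulac (interior_subset hx)).deriv]
        exact (M.dulac'_pos (interior_subset hx)).le
  have hd : ∀ x ∈ Ioo (0 : ℝ) 1, HasDerivAt (fun x => C / M.β * x ^ M.β - M.dulac x)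
      (C * x ^ (M.β - 1) - M.dulac' x) x := fun x hx => by
    refine (((Real.hasDerivAt_rpow_const (Or.inl hx.1.ne')).const_mul _).sub
      (M.hasDerivAt_dulac hx)).congr_deriv ?_
    field_simp
  have hmono' : MonotoneOn (fun x => C / M.β * x ^ M.β - M.dulac x) (Ioo 0 1) :=
    monotoneOn_of_deriv_nonneg (convex_Ioo _ _)
      (fun x hx => (hd x hx).continuousAt.continuousWithinAt)
      (fun x hx => (hd x (interior_subset hx)).differentiableAt.differentiableWithinAt)
      fun x hx => by
        rw [(hd x (interior_subset hx)).deriv]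
        exact sub_nonneg.2 (h x (interior_subset hx)).2
  have key : ∀ x ∈ Ioo (0 : ℝ) 1, ∀ y ∈ Ioo (0 : ℝ) 1, x ≤ y →
      |M.dulac x - M.dulac y| ≤ C / M.β * |x - y| ^ M.β := fun x hx y hy hxy => by
    have h1 := hmono hx hy hxy
    have h2 := hmono' hx hy hxy
    simp only [] at h2
    rw [abs_sub_comm, abs_of_nonneg (sub_nonneg.2 h1), abs_sub_comm,
      abs_of_nonneg (sub_nonneg.2 hxy)]
    have h3 := Real.rpow_add_le_add_rpow hx.1.le (sub_nonneg.2 hxy) hβ.le M.β_lt_one.le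
    rw [add_sub_cancel] at h3
    have h4 : C / M.β * y ^ M.β ≤ C / M.β * (x ^ M.β + (y - x) ^ M.β) := by gcongr
    linarith
  intro x hx y hy
  rcases le_total x y with hxy | hxy
  · exact key x hx y hy hxy
  · rw [abs_sub_comm, abs_sub_comm x]
    exact key y hy x hx hxy

/-- The bound `exp (q/4)` is `x^(-1/2)`, and `dq/dx = -2/x` costs one more power. The flight time
contributes only `O(x^(β-1))`, which is weaker. -/
theorem deriv_time_add_flight {θ : ℝ → ℝ} (hθ : ContDiffOn ℝ 1 θ (Icc 0 1)) :
    ∃ C, 0 ≤ C ∧ ∀ x ∈ Ioo (0 : ℝ) 1, ∃ d,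
      HasDerivAt (fun x => dulacTime M.a₀ M.a₂ M.b₀ M.b₂ x + θ (M.dulac x)) d x ∧
      |d| ≤ C * x ^ (-(3 / 2) : ℝ) := by
  obtain ⟨K, hK, h1⟩ := hθ.exists_abs_deriv_le
  obtain ⟨C₁, hC₁, h2⟩ := M.timeQ_deriv
  obtain ⟨C₂, hC₂, h3⟩ := M.dulac'_bounds
  refine ⟨2 * C₁ + K * C₂, by positivity, fun x hx => ?_⟩
  have hx0 := hx.1
  obtain ⟨d, hd, hd'⟩ := h2 (-(2 * Real.log x)) (by have := Real.log_neg hx.1 hx.2; linarith)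
  have ht : HasDerivAt (dulacTime M.a₀ M.a₂ M.b₀ M.b₂) (d * -(2 * x⁻¹)) x := by
    refine (HasDerivAt.comp x hd (hasDerivAt_neg_two_log hx.1)).congr_of_eventuallyEq ?_
    filter_upwards [isOpen_Ioo.mem_nhds hx] with y hy
    exact (M.dulac_eq_and_dulacTime_eq hy.1 hy.2).2
  obtain ⟨h4, h5⟩ := h1 _ (M.dulac_mem_Ioo hx)
  refine ⟨_, ht.add (h4.comp x (M.hasDerivAt_dulac hx)), (abs_add_le _ _).trans ?_⟩
  rw [add_mul]
  refine add_le_add ?_ ?_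
  · have he : Real.exp (-(2 * Real.log x) / 4) = x ^ (-(1 / 2) : ℝ) := by
      rw [Real.rpow_def_of_pos hx.1]; congr 1; ring
    rw [he] at hd'
    have hx3 : x ^ (-(3 / 2) : ℝ) = x ^ (-(1 / 2) : ℝ) * x⁻¹ := by
      rw [← Real.rpow_neg_one, ← Real.rpow_add hx.1]; norm_num
    rw [abs_mul, abs_neg, abs_of_pos (show 0 < 2 * x⁻¹ by positivity), hx3]
    calc _ ≤ C₁ * x ^ (-(1 / 2) : ℝ) * (2 * x⁻¹) := by gcongr
      _ = _ := by ring
  · rw [abs_mul, abs_of_pos (M.dulac'_pos hx), mul_assoc]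
    refine mul_le_mul h5 ((h3 x hx).2.trans ?_) (M.dulac'_pos hx).le hK
    refine mul_le_mul_of_nonneg_left ?_ hC₂.le
    exact Real.rpow_le_rpow_of_exponent_ge hx.1 hx.2.le (by linarith [M.β_pos])

theorem f_of_pos {x : ℝ} (hx : 0 < x) : M.f x = M.a * M.dulac x - 1 := by simp [f, hx]

theorem f_of_neg {x : ℝ} (hx : x < 0) : M.f x = -(M.a * M.dulac (-x) - 1) := by
  rw [f, if_neg hx.not_gt, if_pos hx]; ring

/-- The map is odd, so its derivative is even and one formula serves both sides. -/
theorem hasDerivAt_f {x : ℝ} (hx : x ≠ 0) (hx1 : |x| < 1) :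
    HasDerivAt M.f (M.a * M.dulac' |x|) x := by
  have hmem : |x| ∈ Ioo (0 : ℝ) 1 := ⟨abs_pos.2 hx, hx1⟩
  have h1 := M.hasDerivAt_dulac hmem
  rcases hx.lt_or_gt with hneg | hpos
  · rw [abs_of_neg hneg] at *
    refine HasDerivAt.congr_of_eventuallyEq (f := fun y => -(M.a * M.dulac (-y) - 1)) ?_ ?_
    · refine ((((h1.comp x (hasDerivAt_neg x)).const_mul M.a).sub_const 1).neg).congr_deriv ?_
      ring
    · filter_upwards [isOpen_Iio.mem_nhds hneg] with y hy using M.f_of_neg hy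
  · rw [abs_of_pos hpos] at *
    refine ((h1.const_mul M.a).sub_const 1).congr_of_eventuallyEq ?_
    filter_upwards [isOpen_Ioi.mem_nhds hpos] with y hy using M.f_of_pos hy

/-- The model satisfies the abstract hypotheses on Lorenz-like maps. -/
theorem exists_isLorenzLike : ∃ C, IsLorenzLike M.f M.r M.β C := by
  have ha := M.one_lt_a
  have ha2 := M.a_le_two
  have ha0 : 0 < M.a := by linarith
  obtain ⟨C₁, hC₁, h₁⟩ := M.dulac'_bounds
  obtain ⟨C₂, hC₂, h₂⟩ := M.log_dulac'_lipschitz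
  obtain ⟨C₃, hC₃, h₃⟩ := M.dulac_hoelder
  obtain ⟨C₄, hC₄, h₄⟩ := M.deriv_time_add_flight M.θpos_smooth
  obtain ⟨C₅, hC₅, h₅⟩ := M.deriv_time_add_flight M.θneg_smooth
  have hroof : ∀ x, x ≠ 0 → |x| < 1 → ∃ d, HasDerivAt M.r d x ∧
      |d| ≤ (C₄ + C₅) * |x| ^ (-(3 / 2) : ℝ) := by
    intro x hx hx1
    have hmem : |x| ∈ Ioo (0 : ℝ) 1 := ⟨abs_pos.2 hx, hx1⟩
    have hnn : 0 ≤ |x| ^ (-(3 / 2) : ℝ) := by positivity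
    rcases hx.lt_or_gt with hneg | hpos
    · obtain ⟨d, hd, hb⟩ := h₅ _ hmem
      rw [abs_of_neg hneg] at *
      refine ⟨-d, ?_, ?_⟩
      · refine ((hd.comp x (hasDerivAt_neg x)).congr_of_eventuallyEq ?_).congr_deriv (by ring)
        filter_upwards [isOpen_Iio.mem_nhds hneg] with y hy
        rw [r, τ₂, if_neg (not_lt_of_gt hy), abs_of_neg hy]
        rfl
      · rw [abs_neg]; nlinarith
    · obtain ⟨d, hd, hb⟩ := h₄ _ hmem
      rw [abs_of_pos hpos] at *
      refine ⟨d, hd.congr_of_eventuallyEq ?_, by nlinarith⟩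
      filter_upwards [isOpen_Ioi.mem_nhds hpos] with y hy
      rw [r, τ₂, if_pos (mem_Ioi.1 hy), abs_of_pos (mem_Ioi.1 hy)]
  -- One constant for all fields; the factors 2 come from `a ≤ 2`.
  set C := 1 + 2 * C₁ + C₂ + 2 * C₃ + (C₄ + C₅) with hC
  refine ⟨C, M.β_pos, M.β_lt_one, by linarith, fun x hx hx1 => ?_,
    fun x hx hx1 => (M.hasDerivAt_f hx hx1).differentiableAt, fun x hx hx1 => ?_,
    fun x hx hx1 => ?_, fun x y hxy hx1 hy1 => ?_, fun x y hxy hx1 hy1 => ?_,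
    fun x hx hx1 => ?_, fun x hx hx1 => ?_⟩
  · have hD := M.dulac_mem_Ioo (x := |x|) ⟨abs_pos.2 hx, hx1⟩
    have key : |M.a * M.dulac |x| - 1| < 1 := abs_lt.2 ⟨by nlinarith [hD.1], by nlinarith [hD.2]⟩
    rcases hx.lt_or_gt with hneg | hpos
    · rwa [M.f_of_neg hneg, abs_neg, ← abs_of_neg hneg]
    · rwa [M.f_of_pos hpos, congrArg M.dulac (abs_of_pos hpos).symm]
  · have hmem : |x| ∈ Ioo (0 : ℝ) 1 := ⟨abs_pos.2 hx, hx1⟩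
    have hp := M.dulac'_pos hmem
    rw [(M.hasDerivAt_f hx hx1).deriv, abs_of_pos (mul_pos ha0 hp)]
    refine (h₁ _ hmem).1.trans ?_
    refine mul_le_mul (by linarith) ?_ hp.le (by linarith)
    nlinarith
  · have hmem : |x| ∈ Ioo (0 : ℝ) 1 := ⟨abs_pos.2 hx, hx1⟩
    have hp := M.dulac'_pos hmem
    rw [(M.hasDerivAt_f hx hx1).deriv, abs_of_pos (mul_pos ha0 hp)]
    calc _ ≤ 2 * (C₁ * |x| ^ (M.β - 1)) := mul_le_mul ha2 (h₁ _ hmem).2 hp.le zero_le_two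
      _ = 2 * C₁ * |x| ^ (M.β - 1) := by ring
      _ ≤ _ := mul_le_mul_of_nonneg_right (by linarith) (by positivity)
  · have hx : x ≠ 0 := left_ne_zero_of_mul hxy.ne'
    have hy : y ≠ 0 := right_ne_zero_of_mul hxy.ne'
    have hmx : |x| ∈ Ioo (0 : ℝ) 1 := ⟨abs_pos.2 hx, hx1⟩
    have hmy : |y| ∈ Ioo (0 : ℝ) 1 := ⟨abs_pos.2 hy, hy1⟩
    rw [(M.hasDerivAt_f hx hx1).deriv, (M.hasDerivAt_f hy hy1).deriv,
      Real.log_mul ha0.ne' (M.dulac'_pos hmx).ne', Real.log_mul ha0.ne' (M.dulac'_pos hmy).ne',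
      add_sub_add_left_eq_sub, ← Real.log_abs x, ← Real.log_abs y]
    exact (h₂ _ hmx _ hmy).trans (mul_le_mul_of_nonneg_right (by linarith) (abs_nonneg _))
  · have hx : x ≠ 0 := left_ne_zero_of_mul hxy.ne'
    have hy : y ≠ 0 := right_ne_zero_of_mul hxy.ne'
    have hmx : |x| ∈ Ioo (0 : ℝ) 1 := ⟨abs_pos.2 hx, hx1⟩
    have hmy : |y| ∈ Ioo (0 : ℝ) 1 := ⟨abs_pos.2 hy, hy1⟩
    have key : |M.f x - M.f y| = M.a * |M.dulac |x| - M.dulac (|y|)| ∧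
        |x - y| = |(|x| - |y|)| := by
      rcases mul_pos_iff.1 hxy with ⟨h1, h2⟩ | ⟨h1, h2⟩
      · rw [M.f_of_pos h1, M.f_of_pos h2, abs_of_pos h1, abs_of_pos h2, ← abs_of_pos ha0,
          ← abs_mul, abs_of_pos ha0]
        exact ⟨by congr 1; ring, rfl⟩
      · rw [M.f_of_neg h1, M.f_of_neg h2, abs_of_neg h1, abs_of_neg h2, ← abs_of_pos ha0,
          ← abs_mul, abs_of_pos ha0, abs_sub_comm]
        exact ⟨by congr 1; ring, by rw [abs_sub_comm]; congr 1; ring⟩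
    rw [key.1, key.2]
    calc _ ≤ 2 * (C₃ * |(|x| - |y|)| ^ M.β) :=
          mul_le_mul ha2 (h₃ _ hmx _ hmy) (abs_nonneg _) zero_le_two
      _ = 2 * C₃ * |(|x| - |y|)| ^ M.β := by ring
      _ ≤ _ := mul_le_mul_of_nonneg_right (by linarith) (by positivity)
  · obtain ⟨d, hd, -⟩ := hroof x hx hx1
    exact hd.differentiableAt
  · obtain ⟨d, hd, hb⟩ := hroof x hx hx1
    rw [hd.deriv]
    exact hb.trans (mul_le_mul_of_nonneg_right (by linarith) (by positivity))

end NeutralModel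

theorem mainTheorem3 (M : NeutralModel) (S : HyperbolicInducing M.f) :
    ∃ C : ℝ, ∀ h : ℝ → ℝ, S.IsInverseBranch h → ∀ x ∈ S.X,
      DifferentiableAt ℝ (S.roof M.r ∘ h) x ∧ |deriv (S.roof M.r ∘ h) x| ≤ C := by
  obtain ⟨C, hC⟩ := M.exists_isLorenzLike
  exact S.exists_bound_deriv_roof_comp hC
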